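/- Conventions. For a finite group $G$ and a symmetric subset $S=S^{-1}\subseteq G$, $\mathrm{Cay}(G,S)$ is the Cayley graph with an edge between $g$ and $gs$ for $g\in G$, $s\in S$; its adjacency operator on $\ell^2(G)$ is $(\mathcal A\varphi)(g)=\sum_{s\in S}\varphi(gs)$, and an eigenfunction of the graph is an eigenfunction of $\mathcal A$. All $\ell^2$ norms are with respect to counting measure. For $\varphi\in\ell^2(G)$ with $\|\varphi\|_{\ell^2}=1$ let $\mu_\varphi=\sum_{g\in G}|\varphi(g)|^2\delta_g$, and write $\mu_\varphi[f]=\sum_{g}|\varphi(g)|^2f(g)$ and $\mu_\varphi[A]=\sum_{g\in A}|\varphi(g)|^2$. $\widehat G$ denotes the set of equivalence classes of irreducible unitary representations $(\pi,V)$ of $G$ on finite-dimensional complex Hilbert spaces, and $\mathrm{triv}$ the class of the trivial representation. Theorem. Let $G_i$ ($i\in\mathbb N$) be finite groups with $|G_i|\to\infty$, let $S_i\subseteq G_i$ be symmetric subsets, let $t_i>0$, and let $M_i\in\mathbb N$ be such that for every $i$ $$2M_i\sum_{(\pi,V)\in\widehat{G_i}\setminus\{\mathrm{triv}\}}(\dim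 V)^2\left(6e^{-t_i\sqrt{\dim V}/64}+2e^{-\dim V/12}\right)<1.$$ Let $f_i^j:G_i\to\mathbb R$, $i\in\mathbb N$, $1\le j\le M_i$, be any functions. Then there exist orthonormal bases $\mathcal B_i$ of $\ell^2(G_i)$ consisting of real-valued eigenfunctions of $\mathrm{Cay}(G_i,S_i)$ such that: 1. For every $i$, every $\varphi\in\mathcal B_i$ and every $1\le j\le M_i$, $$\left|\mu_\varphi[f_i^j]-\frac{\sum_{g\in G_i}f_i^j(g)}{|G_i|}\right|\le t_i\frac{\|f_i^j\|_{\ell^2}}{\sqrt{|G_i|}}.$$ 2. Whenever $f_i^j=\mathbf 1_{A}$ is the indicator function of a subset $A\subseteq G_i$, every $\varphi\in\mathcal B_i$ satisfies $$\left|\mu_\varphi[A]-\frac{|A|}{|G_i|}\right|\le t_i\frac{\sqrt{|A|}}{\sqrt{|G_i|}}.$$ 3. Consequently, let $i$ run through any infinite set of indices, with $1\le j_i\le M_i$, $f_i^{j_i}=\mathbf 1_{A_i}$ for nonempty $A_i\subseteq G_i$, and arbitrary $\varphi_i\in\mathcal B_i$. If $t_i^2|G_i|/|A_i|\to0$ along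 these indices, then $\mu_{\varphi_i}[A_i]\sim|A_i|/|G_i|$ along them. -/

import Mathlib

open MeasureTheory Filter Asymptotics
open scoped Topology Pointwise

/-- A unitary representation of `G` on the standard Hermitian space `ℂ^dim`. Every
finite-dimensional complex Hilbert space is isometric to one of these, so up to equivalence these
are all the finite-dimensional unitary representations of `G`. -/
structure UnitaryRep (G : Type*) [Group G] where
  dim : ℕ
  hom : G →* (EuclideanSpace ℂ (Fin dim) ≃ₗᵢ[ℂ] EuclideanSpace ℂ (Fin dim))

/-- The underlying linear representation. -/
noncomputable def UnitaryRep.toRep {G : Type*} [Group G] (π : UnitaryRep G) :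
    Representation ℂ G (EuclideanSpace ℂ (Fin π.dim)) where
  toFun g := (π.hom g).toLinearEquiv.toLinearMap
  map_one' := by ext1 v; simp
  map_mul' g h := by ext1 v; simp

/-- An irreducible unitary representation of `G`. -/
structure UnitaryIrrep (G : Type*) [Group G] extends UnitaryRep G where
  irreducible : toUnitaryRep.toRep.IsIrreducible

namespace UnitaryIrrep

variable {G : Type*} [Group G]

theorem toRep_apply (π : UnitaryIrrep G) (g : G) (v : EuclideanSpace ℂ (Fin π.dim)) :
    π.toRep g v = π.hom g v := rfl

instance (π : UnitaryIrrep G) : π.toRep.IsIrreducible := π.irreducible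

/-- Two representations are equivalent if there is a unitary isomorphism intertwining them. -/
instance setoid (G : Type*) [Group G] : Setoid (UnitaryIrrep G) where
  r π σ := ∃ T : EuclideanSpace ℂ (Fin π.dim) ≃ₗᵢ[ℂ] EuclideanSpace ℂ (Fin σ.dim),
    ∀ g v, T (π.hom g v) = σ.hom g (T v)
  iseqv :=
    { refl := fun π => ⟨LinearIsometryEquiv.refl ℂ _, fun _ _ => rfl⟩
      symm := by
        rintro π σ ⟨T, hT⟩
        refine ⟨T.symm, fun g v => ?_⟩
        apply T.injective
        rw [hT, T.apply_symm_apply, T.apply_symm_apply]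
      trans := by
        rintro π σ τ ⟨T, hT⟩ ⟨U, hU⟩
        exact ⟨T.trans U, fun g v => by simp [hT, hU]⟩ }

/-- The trivial representation on `ℂ`. -/
noncomputable def triv (G : Type*) [Group G] : UnitaryIrrep G where
  dim := 1
  hom := 1
  irreducible := by
    have h1 : Module.finrank ℂ (EuclideanSpace ℂ (Fin 1)) = 1 := by simp
    have hs : IsSimpleOrder (Submodule ℂ (EuclideanSpace ℂ (Fin 1))) :=
      (isSimpleModule_iff ..).1 (isSimpleModule_iff_finrank_eq_one.2 h1)
    refine { exists_pair_ne := ⟨⊥, ⊤, fun h => ?_⟩, eq_bot_or_eq_top := fun W => ?_ }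
    · exact bot_ne_top (α := Submodule ℂ (EuclideanSpace ℂ (Fin 1)))
        (congrArg Subrepresentation.toSubmodule h)
    · exact (hs.eq_bot_or_eq_top W.toSubmodule).imp
        (fun h => Subrepresentation.toSubmodule_injective h)
        (fun h => Subrepresentation.toSubmodule_injective h)

/-- By Schur's lemma, a linear equivalence of irreducible unitary representations can be
rescaled to a unitary one. -/
theorem equiv_of_linearEquiv {π σ : UnitaryIrrep G} (T : π.toRep.Equiv σ.toRep) : π ≈ σ := by
  have hT : ∀ g v, T (π.hom g v) = σ.hom g (T v) := fun g v =>
    LinearMap.congr_fun (T.isIntertwining' g) v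
  let L : EuclideanSpace ℂ (Fin π.dim) →ₗ[ℂ] EuclideanSpace ℂ (Fin σ.dim) :=
    T.toIntertwiningMap.toLinearMap
  have hL : ∀ v, L v = T v := fun _ => rfl
  let F : π.toRep.IntertwiningMap π.toRep :=
    ⟨L.adjoint ∘ₗ L, fun g => by
      refine LinearMap.ext fun v => ext_inner_right ℂ fun w => ?_
      have h1 : T w = σ.hom g (T ((π.hom g).symm w)) := by
        rw [← hT, LinearIsometryEquiv.apply_symm_apply]
      change inner ℂ (L.adjoint (L (π.hom g v))) w = inner ℂ (π.hom g (L.adjoint (L v))) w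
      rw [LinearMap.adjoint_inner_left, hL, hL, hT, h1, LinearIsometryEquiv.inner_map_map,
        ← hL, ← hL, ← LinearMap.adjoint_inner_left, ← LinearIsometryEquiv.inner_map_map (π.hom g),
        LinearIsometryEquiv.apply_symm_apply]⟩
  obtain ⟨c, hc⟩ :=
    (Representation.IsIrreducible.algebraMap_intertwiningMap_bijective_of_isAlgClosed
      (ρ := π.toRep)).2 F
  have hc' : ∀ v, L.adjoint (L v) = c • v := fun v => by
    have := congrArg (fun f : π.toRep.IntertwiningMap π.toRep => f v) hc
    exact this.symm
  have hn : ∀ v, (‖T v‖ : ℝ) ^ 2 = c.re * ‖v‖ ^ 2 := fun v => by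
    have h1 : inner ℂ (L.adjoint (L v)) v = inner ℂ (L v) (L v) :=
      LinearMap.adjoint_inner_left _ _ _
    rw [hc', inner_smul_left, inner_self_eq_norm_sq_to_K, inner_self_eq_norm_sq_to_K, hL] at h1
    have h2 := congrArg Complex.re h1
    simp only [Complex.coe_algebraMap, ← Complex.ofReal_pow, Complex.ofReal_re,
      Complex.re_mul_ofReal, Complex.conj_re] at h2
    exact h2.symm
  have : Nontrivial (Subrepresentation π.toRep) := π.irreducible.toNontrivial
  obtain ⟨v, hv⟩ : ∃ v : EuclideanSpace ℂ (Fin π.dim), v ≠ 0 := by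
    by_contra! h
    refine bot_ne_top (α := Subrepresentation π.toRep)
      (Subrepresentation.toSubmodule_injective (Submodule.ext fun v => ?_))
    rw [h v]
    exact iff_of_true (Submodule.zero_mem _) (Submodule.zero_mem _)
  have hTv : T v ≠ 0 := fun h => hv (T.toLinearEquiv.map_eq_zero_iff.1 h)
  have hc0 : 0 < c.re := by
    have h1 : 0 < ‖T v‖ ^ 2 := by positivity
    rw [hn] at h1
    exact pos_of_mul_pos_left h1 (by positivity)
  have ha : ((√c.re : ℝ) : ℂ)⁻¹ ≠ 0 := by
    have : √c.re ≠ 0 := (Real.sqrt_pos.2 hc0).ne'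
    simpa using this
  refine ⟨⟨T.toLinearEquiv.trans (LinearEquiv.smulOfNeZero ℂ _ _ ha), fun w => ?_⟩, fun g w => ?_⟩
  · change ‖((√c.re : ℝ) : ℂ)⁻¹ • T w‖ = ‖w‖
    have h1 : ‖T w‖ = √c.re * ‖w‖ := by
      rw [← Real.sqrt_sq (norm_nonneg (T w)), hn, Real.sqrt_mul hc0.le,
        Real.sqrt_sq (norm_nonneg w)]
    have h2 : √c.re ≠ 0 := (Real.sqrt_pos.2 hc0).ne'
    rw [norm_smul, h1, norm_inv, Complex.norm_real, Real.norm_of_nonneg (Real.sqrt_nonneg _)]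
    field_simp
  · change ((√c.re : ℝ) : ℂ)⁻¹ • T (π.hom g w) = σ.hom g (((√c.re : ℝ) : ℂ)⁻¹ • T w)
    rw [hT, map_smul]

end UnitaryIrrep

/-- The unitary dual of `G`. -/
abbrev UnitaryDual (G : Type*) [Group G] := Quotient (UnitaryIrrep.setoid G)

namespace UnitaryDual

variable {G : Type*} [Group G]

/-- The dimension of a class of irreducible representations. -/
def dim (c : UnitaryDual G) : ℕ :=
  Quotient.lift (fun π => π.dim) (by
    rintro π σ ⟨T, -⟩
    simpa using T.toLinearEquiv.finrank_eq) c

/-- The class of the trivial representation. -/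
noncomputable def triv (G : Type*) [Group G] : UnitaryDual G := ⟦UnitaryIrrep.triv G⟧

/-- A finite group has finitely many classes, because their characters are linearly
independent. -/
instance [Finite G] : Finite (UnitaryDual G) := by
  classical
  have := Fintype.ofFinite G
  have hcard : (Nat.card G : ℂ) ≠ 0 := Nat.cast_ne_zero.2 Nat.card_pos.ne'
  let _ : Invertible (Nat.card G : ℂ) := invertibleOfNonzero hcard
  let χ : UnitaryDual G → G → ℂ := fun c => c.out.toRep.character
  have hχ : ∀ c d : UnitaryDual G,
      ∑ g, χ c g * χ d g⁻¹ = if c = d then (Nat.card G : ℂ) else 0 := fun c d => by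
    have h := Representation.char_orthonormal c.out.toRep d.out.toRep
    rw [inv_mul_eq_iff_eq_mul₀ hcard] at h
    refine h.trans ?_
    by_cases hcd : c = d
    · subst hcd
      rw [if_pos ⟨Representation.Equiv.refl _⟩, if_pos rfl, mul_one]
    · rw [if_neg, if_neg hcd, mul_zero]
      rintro ⟨T⟩
      have h1 := Quotient.sound (UnitaryIrrep.equiv_of_linearEquiv T)
      rw [Quotient.out_eq, Quotient.out_eq] at h1
      exact hcd h1.symm
  have hli : LinearIndependent ℂ χ := by
    rw [linearIndependent_iff']
    intro s a h d hd
    have h1 : ∑ g, (∑ c ∈ s, a c • χ c) g * χ d g⁻¹ = 0 := by rw [h]; simp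
    simp only [Finset.sum_apply, Pi.smul_apply, smul_eq_mul, Finset.sum_mul, mul_assoc] at h1
    rw [Finset.sum_comm] at h1
    simp only [← Finset.mul_sum, hχ, mul_ite, mul_zero, Finset.sum_ite_eq', hd, if_true] at h1
    exact (mul_eq_zero.1 h1).resolve_right hcard
  exact hli.finite

noncomputable instance [Finite G] : Fintype (UnitaryDual G) := Fintype.ofFinite _

noncomputable instance : DecidableEq (UnitaryDual G) := Classical.decEq _

end UnitaryDual

section Cayley

variable {G : Type*} [Group G] [Fintype G]

open Classical in
/-- The adjacency matrix of `Cay(G, S)`: the entry at `(g, h)` is `1` if `g * s = h` for some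
`s ∈ S`, and `0` otherwise. -/
noncomputable def cayleyMatrix (S : Set G) : Matrix G G ℂ :=
  Matrix.of fun g h => if ∃ s ∈ S, g * s = h then 1 else 0

open Classical in
/-- The adjacency operator of `Cay(G, S)` on `ℓ²(G)`. -/
noncomputable def adjacencyOperator (S : Set G) :
    EuclideanSpace ℂ G →ₗ[ℂ] EuclideanSpace ℂ G :=
  Matrix.toEuclideanLin (cayleyMatrix S)

open Classical in
theorem adjacencyOperator_apply (S : Set G) (φ : EuclideanSpace ℂ G) (g : G) :
    adjacencyOperator S φ g = ∑ s ∈ S.toFinset, φ (g * s) := by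
  have h : ∀ h : G, (∃ s ∈ S, g * s = h) ↔ g⁻¹ * h ∈ S := fun h =>
    ⟨by rintro ⟨s, hs, rfl⟩; simpa using hs, fun hs => ⟨_, hs, by simp⟩⟩
  simp only [adjacencyOperator, cayleyMatrix, Matrix.toLpLin_apply, Matrix.mulVec, dotProduct,
    Matrix.of_apply, h]
  rw [← Equiv.sum_comp (Equiv.mulLeft g)]
  simp only [Equiv.coe_mulLeft, inv_mul_cancel_left, ite_mul, one_mul, zero_mul]
  rw [← Finset.sum_filter]
  congr 1
  ext; simp

/-- `φ` is an eigenfunction of the adjacency operator of `Cay(G, S)`. -/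
def IsCayleyEigenfunction (S : Set G) (φ : EuclideanSpace ℂ G) : Prop :=
  ∃ lam : ℂ, Module.End.HasEigenvector (adjacencyOperator S) lam φ

end Cayley

section Quantum

variable {V : Type*} [Fintype V]

/-- The quantum measure `∑ v, |φ v|² δ_v` of `φ`, on the σ-algebra of all subsets. -/
noncomputable def quantumMeasure (φ : EuclideanSpace ℂ V) : @Measure V ⊤ :=
  letI : MeasurableSpace V := ⊤
  ∑ v, ENNReal.ofReal (‖φ v‖ ^ 2) • Measure.dirac v

theorem integral_quantumMeasure (φ : EuclideanSpace ℂ V) (f : V → ℝ) :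
    ∫ v, f v ∂(quantumMeasure φ) = ∑ v, ‖φ v‖ ^ 2 * f v := by
  let _ : MeasurableSpace V := ⊤
  have : DiscreteMeasurableSpace V := ⟨fun _ => trivial⟩
  unfold quantumMeasure
  rw [integral_finsetSum_measure]
  · simp [integral_smul_measure]
  · intro v _
    exact (integrable_dirac (by simp)).smul_measure (by simp)

open Classical in
theorem quantumMeasure_real (φ : EuclideanSpace ℂ V) (A : Set V) :
    (quantumMeasure φ).real A = ∑ v ∈ A.toFinset, ‖φ v‖ ^ 2 := by
  let _ : MeasurableSpace V := ⊤
  have : DiscreteMeasurableSpace V := ⟨fun _ => trivial⟩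
  have h := integral_quantumMeasure φ (A.indicator 1)
  rw [integral_indicator_one (MeasurableSet.of_discrete)] at h
  rw [h]
  simp only [Set.indicator_apply, Pi.one_apply, mul_ite, mul_one, mul_zero]
  rw [← Finset.sum_filter]
  congr 1
  ext; simp

end Quantum

/-!
Work with real functions. The adjacency operator of `Cay(G, S)` is symmetric and commutes with left
translations, so `ℓ²(G, ℝ)` is an orthogonal sum of left-invariant spaces `W`, each inside one
eigenspace. Every `W` can be taken to be the space of real parts of an irreducible subspace `U` of
`ℓ²(G, ℂ)` (`IsLeftInvariant.exists_le_finrank`), so that with `d = dim U` and `D = dim W` one has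
`d ≤ D ≤ 2 * d`; this treats irreducible representations of real, complex and quaternionic type
alike. Any orthonormal basis of `W` consists of eigenfunctions, and a random one is chosen.

For a test function `f` with mean subtracted, `φ ↦ ∑ f φ²` is a quadratic form on `W`. Left
invariance makes `∑ b(g)²`, over an orthonormal basis of `W`, equal to `D / |G|` for every `g`
(`IsLeftInvariant.sum_sq_apply`). Hence the form is traceless and its Hilbert–Schmidt norm is at
most `‖f‖ * √(D / |G|)` (`IsLeftInvariant.sum_sq_inner_compressedMul_le`). For a unit vector `φ`,
exceeding `t * ‖f‖ / √|G|` is membership in a cone. Its Gaussian measure is bounded by Chernoff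
estimates for the form and for the squared norm (`gaussianPi_real_cone_le`). Since a vector of a
Haar-random orthonormal basis is uniform on the sphere, this measure is also the probability that
the vector lies in the cone, and a union bound gives a basis that avoids the cones of all test
functions (`exists_orthonormalBasis_forall_notMem`). The union bound is applied to each `W`
separately, where the summand of the class of `U` in the hypothesis is enough
(`mul_tailBound_lt_one`). If `U` is trivial, `W` consists of constants and there is no error.
-/

/-! ### Quadratic forms in Gaussian vectors -/

open ProbabilityTheory in
theorem integrable_exp_mul_sq_gaussianReal {a : ℝ} (ha : a < 1 / 2) :
    Integrable (fun y => Real.exp (a * y ^ 2)) (gaussianReal 0 1) := by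
  rw [gaussianReal_of_var_ne_zero _ one_ne_zero,
    integrable_withDensity_iff_integrable_smul₀' (measurable_gaussianPDF 0 1).aemeasurable
      (ae_of_all _ fun _ => gaussianPDF_lt_top)]
  simp only [toReal_gaussianPDF, gaussianPDFReal, smul_eq_mul, mul_assoc, ← Real.exp_add]
  refine Integrable.const_mul ?_ _
  refine (integrable_exp_neg_mul_sq (b := 1 / 2 - a) (by linarith)).congr (ae_of_all _ fun y => ?_)
  simp only [NNReal.coe_one]
  congr 1
  ring

open ProbabilityTheory in
theorem integral_exp_mul_sq_gaussianReal {a : ℝ} (ha : a < 1 / 2) :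
    ∫ y, Real.exp (a * y ^ 2) ∂gaussianReal 0 1 = (√(1 - 2 * a))⁻¹ := by
  rw [integral_gaussianReal_eq_integral_smul one_ne_zero]
  simp only [gaussianPDFReal, smul_eq_mul, mul_assoc, ← Real.exp_add]
  have h : ∀ y : ℝ, -(y - 0) ^ 2 / (2 * ((1 : NNReal) : ℝ)) + a * y ^ 2 = -(1 / 2 - a) * y ^ 2 :=
    fun y => by simp only [NNReal.coe_one]; ring
  simp only [h]
  rw [integral_const_mul, integral_gaussian, ← Real.sqrt_inv, ← Real.sqrt_mul (by positivity),
    ← Real.sqrt_inv]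
  congr 1
  have : 1 / 2 - a ≠ 0 := by linarith
  have : 1 - 2 * a ≠ 0 := by linarith
  simp only [NNReal.coe_one]
  field_simp

/-- The standard Gaussian measure on `ι → ℝ`. -/
noncomputable abbrev gaussianPi (ι : Type*) [Fintype ι] : Measure (ι → ℝ) :=
  Measure.pi fun _ => ProbabilityTheory.gaussianReal 0 1

theorem integrable_exp_sum_mul_sq {ι : Type*} [Fintype ι] {a : ι → ℝ} (ha : ∀ i, a i < 1 / 2) :
    Integrable (fun y => Real.exp (∑ i, a i * y i ^ 2)) (gaussianPi ι) := by
  simp only [Real.exp_sum]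
  exact Integrable.fintype_prod (f := fun i y => Real.exp (a i * y ^ 2))
    fun i => integrable_exp_mul_sq_gaussianReal (ha i)

theorem integral_exp_sum_mul_sq {ι : Type*} [Fintype ι] {a : ι → ℝ} (ha : ∀ i, a i < 1 / 2) :
    ∫ y, Real.exp (∑ i, a i * y i ^ 2) ∂gaussianPi ι = ∏ i, (√(1 - 2 * a i))⁻¹ := by
  simp only [Real.exp_sum]
  rw [integral_fintype_prod_eq_prod (f := fun i y => Real.exp (a i * y ^ 2))]
  exact Finset.prod_congr rfl fun i _ => integral_exp_mul_sq_gaussianReal (ha i)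

/-- The bound `-log (1 - x) / 2 ≤ x / 2 + x ^ 2 / 2` for `|x| ≤ 1 / 2`, at `x = 2 * a`. -/
theorem inv_sqrt_one_sub_two_mul_le {a : ℝ} (h : |a| ≤ 1 / 4) :
    (√(1 - 2 * a))⁻¹ ≤ Real.exp (a + 2 * a ^ 2) := by
  obtain ⟨h1, h2⟩ := abs_le.1 h
  have key : Real.exp (-(2 * a + 4 * a ^ 2)) ≤ 1 - 2 * a := by
    rw [Real.exp_neg]
    rcases le_total a 0 with h0 | h0
    · have hp : 0 < 2 * a + 4 * a ^ 2 + 1 := by nlinarith [sq_nonneg (2 * a + 1 / 2)]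
      refine (inv_anti₀ hp (Real.add_one_le_exp _)).trans ?_
      rw [inv_le_iff_one_le_mul₀ hp]
      nlinarith [mul_nonneg (neg_nonneg.2 h0) (sq_nonneg a)]
    · have hp : 0 < 1 + (2 * a + 4 * a ^ 2) + (2 * a + 4 * a ^ 2) ^ 2 / 2 := by positivity
      refine (inv_anti₀ hp (Real.quadratic_le_exp_of_nonneg (by positivity))).trans ?_
      rw [inv_le_iff_one_le_mul₀ hp]
      have h3 : 0 ≤ 1 - 2 * a - (2 * a) ^ 2 - (2 * a) ^ 3 := by nlinarith [mul_nonneg h0 h0]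
      nlinarith [mul_nonneg (sq_nonneg a) h3]
  have hs : Real.exp (-(a + 2 * a ^ 2)) ≤ √(1 - 2 * a) := by
    refine Real.le_sqrt_of_sq_le ?_
    rw [← Real.exp_nat_mul]
    convert key using 2
    push_cast
    ring
  have := inv_anti₀ (Real.exp_pos _) hs
  rwa [Real.exp_neg, inv_inv] at this

/-- Chernoff bound for a traceless diagonal quadratic form, with parameter `1 / (4 * H)`. -/
theorem gaussianPi_real_quadratic_ge_le {ι : Type*} [Fintype ι] {τ : ι → ℝ} (hτ : ∑ i, τ i = 0)
    {H : ℝ} (hH : 0 < H) (hτ2 : ∑ i, τ i ^ 2 ≤ H ^ 2) (u : ℝ) :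
    (gaussianPi ι).real {y | u ≤ ∑ i, τ i * y i ^ 2} ≤
      Real.exp (1 / 8) * Real.exp (-(u / (4 * H))) := by
  have ha : ∀ i, |(4 * H)⁻¹ * τ i| ≤ 1 / 4 := fun i => by
    have h1 : |τ i| ≤ H := abs_le_of_sq_le_sq
      ((Finset.single_le_sum (f := fun i => τ i ^ 2) (fun i _ => sq_nonneg _)
        (Finset.mem_univ i)).trans hτ2) hH.le
    rw [abs_mul, abs_of_pos (by positivity), inv_mul_le_iff₀ (by positivity)]
    linarith
  have ha2 : ∀ i, (4 * H)⁻¹ * τ i < 1 / 2 := fun i => by linarith [(abs_le.1 (ha i)).2]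
  have heq : ∀ y : ι → ℝ, (4 * H)⁻¹ * ∑ i, τ i * y i ^ 2 = ∑ i, (4 * H)⁻¹ * τ i * y i ^ 2 :=
    fun y => by simp only [Finset.mul_sum, mul_assoc]
  have hint : Integrable (fun y : ι → ℝ => Real.exp ((4 * H)⁻¹ * ∑ i, τ i * y i ^ 2))
      (gaussianPi ι) := by
    simp only [heq]
    exact integrable_exp_sum_mul_sq ha2
  refine (ProbabilityTheory.measure_ge_le_exp_mul_mgf u (by positivity) hint).trans ?_
  rw [ProbabilityTheory.mgf, mul_comm]
  simp only [heq]
  rw [integral_exp_sum_mul_sq ha2]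
  refine mul_le_mul ?_ (le_of_eq ?_) (Real.exp_pos _).le (Real.exp_pos _).le
  · refine (Finset.prod_le_prod (fun i _ => by positivity)
      fun i _ => inv_sqrt_one_sub_two_mul_le (ha i)).trans ?_
    rw [← Real.exp_sum, Finset.sum_add_distrib, ← Finset.mul_sum, hτ, mul_zero, zero_add]
    refine Real.exp_le_exp.2 ?_
    have : ∑ i, 2 * ((4 * H)⁻¹ * τ i) ^ 2 = 2 * ((4 * H)⁻¹) ^ 2 * ∑ i, τ i ^ 2 := by
      rw [Finset.mul_sum]
      exact Finset.sum_congr rfl fun i _ => by ring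
    rw [this]
    refine (mul_le_mul_of_nonneg_left hτ2 (by positivity)).trans (le_of_eq ?_)
    field_simp
    norm_num
  · congr 1
    field_simp

/-- Chernoff bound for the lower tail of the squared norm, with the optimal parameter `-1 / 2`; the
rate is `log 2 / 2 - 1 / 4 > 1 / 12`. -/
theorem gaussianPi_real_sum_sq_le_half {ι : Type*} [Fintype ι] :
    (gaussianPi ι).real {y | ∑ i, y i ^ 2 ≤ Fintype.card ι / 2} ≤
      Real.exp (-((Fintype.card ι : ℝ) / 12)) := by
  have heq : ∀ y : ι → ℝ, (-(1 / 2)) * ∑ i, y i ^ 2 = ∑ i, (-(1 / 2) : ℝ) * y i ^ 2 :=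
    fun y => by simp only [Finset.mul_sum]
  have ha : ∀ _ : ι, (-(1 / 2) : ℝ) < 1 / 2 := fun _ => by norm_num
  have hint : Integrable (fun y : ι → ℝ => Real.exp ((-(1 / 2)) * ∑ i, y i ^ 2))
      (gaussianPi ι) := by
    simp only [heq]
    exact integrable_exp_sum_mul_sq ha
  refine (ProbabilityTheory.measure_le_le_exp_mul_mgf _ (by norm_num) hint).trans ?_
  rw [ProbabilityTheory.mgf]
  simp only [heq]
  rw [integral_exp_sum_mul_sq ha, Finset.prod_const, Finset.card_univ]
  have h2 : (√(1 - 2 * (-(1 / 2) : ℝ)))⁻¹ = Real.exp (-(Real.log 2 / 2)) := by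
    rw [Real.exp_neg, Real.exp_half, Real.exp_log (by norm_num)]
    norm_num
  rw [h2, ← Real.exp_nat_mul, ← Real.exp_add]
  refine Real.exp_le_exp.2 ?_
  have h3 : (1 / 3 : ℝ) ≤ Real.log 2 / 2 := by linarith [Real.log_two_gt_d9]
  nlinarith [(Nat.cast_nonneg (Fintype.card ι) : (0 : ℝ) ≤ _)]

/-- The cone on which a traceless diagonal form of Hilbert–Schmidt norm at most `H` exceeds
`t * H / √D` times the squared norm: either the squared norm is below half its mean `D`, or the
form itself is large. -/
theorem gaussianPi_real_cone_le {ι : Type*} [Fintype ι] [Nonempty ι] {τ : ι → ℝ}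
    (hτ : ∑ i, τ i = 0) {H : ℝ} (hH : 0 ≤ H) (hτ2 : ∑ i, τ i ^ 2 ≤ H ^ 2) {t : ℝ} (ht : 0 ≤ t) :
    (gaussianPi ι).real {y | t * H / √(Fintype.card ι) * ∑ i, y i ^ 2 < |∑ i, τ i * y i ^ 2|} ≤
      2 * Real.exp (1 / 8) * Real.exp (-(t * √(Fintype.card ι) / 8)) +
        Real.exp (-((Fintype.card ι : ℝ) / 12)) := by
  rcases hH.eq_or_lt with rfl | hH
  · have h0 : ∀ i, τ i = 0 := fun i => by
      have := (Finset.single_le_sum (f := fun i => τ i ^ 2) (fun i _ => sq_nonneg _)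
        (Finset.mem_univ i)).trans hτ2
      exact pow_eq_zero_iff two_ne_zero |>.1 (le_antisymm (by simpa using this) (sq_nonneg _))
    simp only [h0, mul_zero, zero_div, zero_mul, Finset.sum_const_zero, abs_zero, lt_self_iff_false,
      Set.ofPred_false, measureReal_empty]
    positivity
  have hD : (0 : ℝ) < Fintype.card ι := by exact_mod_cast Fintype.card_pos
  set D := (Fintype.card ι : ℝ)
  have hsD : √D * √D = D := Real.mul_self_sqrt hD.le
  have hsD0 : 0 < √D := Real.sqrt_pos.2 hD
  set u := t * H * √D / 2 with hu
  have hsub : {y : ι → ℝ | t * H / √D * ∑ i, y i ^ 2 < |∑ i, τ i * y i ^ 2|} ⊆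
      ({y | u ≤ ∑ i, τ i * y i ^ 2} ∪ {y | u ≤ ∑ i, (-τ i) * y i ^ 2}) ∪
        {y | ∑ i, y i ^ 2 ≤ D / 2} := by
    intro y hy
    rw [Set.mem_ofPred_eq] at hy
    by_cases h : ∑ i, y i ^ 2 ≤ D / 2
    · exact Or.inr h
    left
    have h1 : u ≤ |∑ i, τ i * y i ^ 2| := by
      refine le_trans ?_ hy.le
      have : u = t * H / √D * (D / 2) := by
        rw [hu]; field_simp; rw [pow_two, hsD]
      rw [this]
      exact mul_le_mul_of_nonneg_left (not_le.1 h).le (by positivity)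
    simpa [le_abs] using h1
  refine (measureReal_mono hsub).trans ((measureReal_union_le _ _).trans ?_)
  refine add_le_add ((measureReal_union_le _ _).trans ?_) gaussianPi_real_sum_sq_le_half
  have h1 := gaussianPi_real_quadratic_ge_le hτ hH hτ2 u
  have h2 := gaussianPi_real_quadratic_ge_le (τ := fun i => -τ i) (by simp [hτ]) hH
    (by simpa using hτ2) u
  have h3 : u / (4 * H) = t * √D / 8 := by rw [hu]; field_simp; ring
  rw [h3] at h1 h2
  linarith

/-! ### Random orthonormal bases -/

section RandomBasis

variable {F : Type*} [NormedAddCommGroup F] [InnerProductSpace ℝ F]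

theorem exists_unitary_apply_eq [CompleteSpace F] {x y : F} (h : ‖x‖ = ‖y‖) :
    ∃ V : unitary (F →L[ℝ] F), (V : F →L[ℝ] F) x = y := by
  refine ⟨Unitary.linearIsometryEquiv.symm (ℝ ∙ (x - y))ᗮ.reflection, ?_⟩
  rw [Unitary.coe_symm_linearIsometryEquiv_apply]
  exact Submodule.reflection_sub h

variable [FiniteDimensional ℝ F]

theorem isCompact_unitary_clm [CompleteSpace F] [Nontrivial F] :
    IsCompact (unitary (F →L[ℝ] F) : Set (F →L[ℝ] F)) := by
  have : ProperSpace (F →L[ℝ] F) := FiniteDimensional.proper ℝ _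
  refine Metric.isCompact_of_isClosed_isBounded isClosed_unitary ?_
  refine (Metric.isBounded_closedBall (x := (0 : F →L[ℝ] F)) (r := 1)).subset fun U hU => ?_
  rw [mem_closedBall_zero_iff]
  exact (CStarRing.norm_of_mem_unitary hU).le

theorem stdGaussian_singleton_zero [Nontrivial F] [MeasurableSpace F] [BorelSpace F] :
    ProbabilityTheory.stdGaussian F {0} = 0 := by
  obtain ⟨v, hv⟩ := exists_norm_eq F zero_le_one
  have h := ProbabilityTheory.IsGaussian.map_eq_gaussianReal
    (μ := ProbabilityTheory.stdGaussian F) (innerSL ℝ v)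
  rw [ProbabilityTheory.variance_dual_stdGaussian, innerSL_apply_norm, hv] at h
  have h0 : (ProbabilityTheory.stdGaussian F).map (innerSL ℝ v) {0} = 0 := by
    rw [h]
    have := ProbabilityTheory.nullSingletonClass_gaussianReal
      (μ := ∫ x, innerSL ℝ v x ∂ProbabilityTheory.stdGaussian F)
      (v := ((1 : ℝ) ^ 2).toNNReal) (by simp)
    exact measure_singleton 0
  rw [Measure.map_apply (by fun_prop) (measurableSet_singleton _)] at h0
  exact measure_mono_null (by simp) h0

/-- Let `C` be a cone of Gaussian measure less than `1 / dim F`. The image of a fixed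
orthonormal basis under a Haar-random isometry `U` avoids `C` with positive probability: each
`U b` is uniform on the sphere, so it lies in `C` with probability the Gaussian measure of `C`,
and the union bound applies. -/
theorem exists_orthonormalBasis_forall_notMem [Nontrivial F] [MeasurableSpace F] [BorelSpace F]
    {C : Set F} (hC : MeasurableSet C) (hcone : ∀ (r : ℝ) x, r ≠ 0 → (r • x ∈ C ↔ x ∈ C))
    (hlt : (Module.finrank ℝ F : ℝ) * (ProbabilityTheory.stdGaussian F).real C < 1) :
    ∃ b : OrthonormalBasis (Fin (Module.finrank ℝ F)) ℝ F, ∀ i, b i ∉ C := by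
  have : CompleteSpace F := FiniteDimensional.complete ℝ F
  have : CompactSpace (unitary (F →L[ℝ] F)) := isCompact_iff_compactSpace.1 isCompact_unitary_clm
  have : ProperSpace (F →L[ℝ] F) := FiniteDimensional.proper ℝ _
  let _ : MeasurableSpace (unitary (F →L[ℝ] F)) := borel _
  have : BorelSpace (unitary (F →L[ℝ] F)) := ⟨rfl⟩
  let ν : Measure (unitary (F →L[ℝ] F)) := Measure.haarMeasure ⊤
  have : IsProbabilityMeasure ν := ⟨Measure.haarMeasure_self⟩
  let γ := ProbabilityTheory.stdGaussian F
  let act : unitary (F →L[ℝ] F) × F → F := fun p => ((p.1⁻¹ : unitary (F →L[ℝ] F)) : F →L[ℝ] F) p.2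
  have hact : Continuous act := by
    have h1 : Continuous fun p : unitary (F →L[ℝ] F) × F =>
        ((p.1⁻¹ : unitary (F →L[ℝ] F)) : F →L[ℝ] F) :=
      continuous_subtype_val.comp (continuous_inv.comp continuous_fst)
    exact h1.clm_apply continuous_snd
  have hactm : MeasurableSet (act ⁻¹' C) := hact.measurable hC
  let h : F → ENNReal := fun x => ν ((fun U => (U, x)) ⁻¹' (act ⁻¹' C))
  -- left invariance of `ν` makes `h` invariant under isometries
  have hinv : ∀ (V : unitary (F →L[ℝ] F)) x, h ((V : F →L[ℝ] F) x) = h x := by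
    intro V x
    refine (measure_preimage_mul ν V _).symm.trans ?_
    refine congrArg ν (Set.ext fun U => ?_)
    have : ((V * U)⁻¹ : unitary (F →L[ℝ] F)) * V = U⁻¹ := by group
    have h2 : act (V * U, (V : F →L[ℝ] F) x) = act (U, x) := by
      change (((V * U)⁻¹ : unitary (F →L[ℝ] F)) : F →L[ℝ] F) ((V : F →L[ℝ] F) x) =
        ((U⁻¹ : unitary (F →L[ℝ] F)) : F →L[ℝ] F) x
      rw [← this]
      rfl
    simp only [Set.mem_preimage, h2]
  have hsmul : ∀ (r : ℝ) x, r ≠ 0 → h (r • x) = h x := by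
    intro r x hr
    refine congrArg ν (Set.ext fun U => ?_)
    have : act (U, r • x) = r • act (U, x) := map_smul _ r x
    simp only [Set.mem_preimage, this, hcone r _ hr]
  obtain ⟨e, he⟩ := exists_norm_eq F zero_le_one
  have hconst : ∀ x, x ≠ 0 → h x = h e := by
    intro x hx
    have hx' : ‖x‖⁻¹ ≠ 0 := inv_ne_zero (norm_ne_zero_iff.2 hx)
    rw [← hsmul _ x hx']
    obtain ⟨V, hV⟩ := exists_unitary_apply_eq (x := e) (y := ‖x‖⁻¹ • x)
      (by rw [he, norm_smul, norm_inv, norm_norm, inv_mul_cancel₀ (norm_ne_zero_iff.2 hx)])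
    rw [← hV, hinv]
  have hγ : ∀ U : unitary (F →L[ℝ] F), γ (Prod.mk U ⁻¹' (act ⁻¹' C)) = γ C := by
    intro U
    have h1 := ProbabilityTheory.stdGaussian_map (Unitary.linearIsometryEquiv U⁻¹)
    conv_rhs => rw [show γ = ProbabilityTheory.stdGaussian F from rfl, ← h1]
    rw [Measure.map_apply (by fun_prop) hC]
    rfl
  have hprod : h e = γ C := by
    have h1 : (ν.prod γ) (act ⁻¹' C) = γ C := by
      rw [Measure.prod_apply hactm]
      simp [hγ]
    have h2 : (ν.prod γ) (act ⁻¹' C) = h e := by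
      rw [Measure.prod_apply_symm hactm]
      have : (fun y => ν ((fun x => (x, y)) ⁻¹' (act ⁻¹' C))) =ᵐ[γ] fun _ => h e := by
        filter_upwards [measure_eq_zero_iff_ae_notMem.1 stdGaussian_singleton_zero] with x hx
        exact hconst x hx
      rw [lintegral_congr_ae this]
      simp
    rw [← h2, h1]
  let b₀ := stdOrthonormalBasis ℝ F
  have hunion : ν (⋃ i, (fun U => (U, b₀ i)) ⁻¹' (act ⁻¹' C)) < 1 := by
    refine (measure_iUnion_fintype_le _ _).trans_lt ?_
    have h1 : ∀ i, ν ((fun U => (U, b₀ i)) ⁻¹' (act ⁻¹' C)) = γ C := fun i => by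
      rw [← hprod]
      exact hconst _ (b₀.orthonormal.ne_zero i)
    simp only [h1, Finset.sum_const, Finset.card_univ, Fintype.card_fin, nsmul_eq_mul]
    rw [← ENNReal.ofReal_toReal (measure_ne_top γ C), ← ENNReal.ofReal_natCast,
      ← ENNReal.ofReal_mul (Nat.cast_nonneg _), ENNReal.ofReal_lt_one]
    exact hlt
  obtain ⟨U, hU⟩ : ∃ U, U ∉ ⋃ i, (fun U => (U, b₀ i)) ⁻¹' (act ⁻¹' C) := by
    by_contra! hcon
    rw [Set.eq_univ_of_forall hcon, measure_univ] at hunion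
    exact lt_irrefl _ hunion
  refine ⟨b₀.map (Unitary.linearIsometryEquiv U⁻¹), fun i hi => hU ?_⟩
  exact Set.mem_iUnion.2 ⟨i, hi⟩

end RandomBasis

/-! ### Cones of quadratic forms -/

/-- The cone of vectors at which the quadratic form of `T` exceeds `s` times the squared norm. -/
def quadraticCone {F : Type*} [NormedAddCommGroup F] [InnerProductSpace ℝ F] (T : F →ₗ[ℝ] F)
    (s : ℝ) : Set F :=
  {x | s * ‖x‖ ^ 2 < |inner ℝ (T x) x|}

theorem smul_mem_quadraticCone_iff {F : Type*} [NormedAddCommGroup F] [InnerProductSpace ℝ F]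
    {T : F →ₗ[ℝ] F} {s r : ℝ} {x : F} (hr : r ≠ 0) :
    r • x ∈ quadraticCone T s ↔ x ∈ quadraticCone T s := by
  have h0 : 0 < r ^ 2 := by positivity
  have h1 : inner ℝ (T (r • x)) (r • x) = r ^ 2 * inner ℝ (T x) x := by
    rw [map_smul, real_inner_smul_left, real_inner_smul_right]
    ring
  have h2 : s * ‖r • x‖ ^ 2 = r ^ 2 * (s * ‖x‖ ^ 2) := by
    rw [norm_smul, mul_pow, Real.norm_eq_abs, sq_abs]
    ring
  simp only [quadraticCone, Set.mem_ofPred_eq]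
  rw [h1, h2, abs_mul, abs_of_pos h0, mul_lt_mul_iff_of_pos_left h0]

theorem measurableSet_quadraticCone {F : Type*} [NormedAddCommGroup F] [InnerProductSpace ℝ F]
    [FiniteDimensional ℝ F] [MeasurableSpace F] [BorelSpace F] (T : F →ₗ[ℝ] F) (s : ℝ) :
    MeasurableSet (quadraticCone T s) := by
  have : Continuous T := T.continuous_of_finiteDimensional
  exact (isOpen_lt (by fun_prop) (by fun_prop)).measurableSet

/-- The tail bound for the quadratic form of a symmetric operator `T` in a standard Gaussian
vector. The hypotheses say that `T` has trace `0` and Hilbert–Schmidt norm at most `H`; they are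
used for an eigenbasis of `T`. -/
theorem stdGaussian_real_cone_le {F : Type*} [NormedAddCommGroup F] [InnerProductSpace ℝ F]
    [FiniteDimensional ℝ F] [Nontrivial F] [MeasurableSpace F] [BorelSpace F] {T : F →ₗ[ℝ] F}
    (hT : T.IsSymmetric) {H t : ℝ} (hH : 0 ≤ H) (ht : 0 ≤ t)
    (htr : ∀ b : OrthonormalBasis (Fin (Module.finrank ℝ F)) ℝ F,
      ∑ i, inner ℝ (T (b i)) (b i) = 0)
    (hHS : ∀ b : OrthonormalBasis (Fin (Module.finrank ℝ F)) ℝ F,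
      ∑ i, inner ℝ (T (b i)) (b i) ^ 2 ≤ H ^ 2) :
    (ProbabilityTheory.stdGaussian F).real (quadraticCone T (t * H / √(Module.finrank ℝ F))) ≤
      2 * Real.exp (1 / 8) * Real.exp (-(t * √(Module.finrank ℝ F) / 8)) +
        Real.exp (-((Module.finrank ℝ F : ℝ) / 12)) := by
  let b := hT.eigenvectorBasis rfl
  have hb : ∀ i, T (b i) = hT.eigenvalues rfl i • b i := fun i =>
    hT.apply_eigenvectorBasis rfl i
  have hbi : ∀ i, inner ℝ (T (b i)) (b i) = hT.eigenvalues rfl i := fun i => by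
    rw [hb, inner_smul_left, real_inner_self_eq_norm_sq, b.orthonormal.1 i]
    simp
  have hpos : 0 < Module.finrank ℝ F := Module.finrank_pos
  have : Nonempty (Fin (Module.finrank ℝ F)) := ⟨⟨0, hpos⟩⟩
  have key := gaussianPi_real_cone_le (τ := hT.eigenvalues rfl)
    (by simpa only [hbi] using htr b) hH (by simpa only [hbi] using hHS b) ht
  rw [Fintype.card_fin] at key
  refine le_trans (le_of_eq ?_) key
  rw [ProbabilityTheory.stdGaussian_eq_map_pi_orthonormalBasis b,
    map_measureReal_apply (by fun_prop) (measurableSet_quadraticCone _ _)]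
  congr 1
  ext y
  have h1 : ‖∑ i, y i • b i‖ ^ 2 = ∑ i, y i ^ 2 := by
    rw [← real_inner_self_eq_norm_sq, b.orthonormal.inner_sum]
    exact Finset.sum_congr rfl fun i _ => by simp [pow_two]
  have h2 : inner ℝ (T (∑ i, y i • b i)) (∑ i, y i • b i) =
      ∑ i, hT.eigenvalues rfl i * y i ^ 2 := by
    simp only [map_sum, map_smul, hb, smul_smul]
    rw [b.orthonormal.inner_sum]
    exact Finset.sum_congr rfl fun i _ => by simp; ring
  simp only [quadraticCone, Set.mem_preimage, Set.mem_ofPred_eq, h1, h2]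

/-! ### Left-invariant function spaces -/

/-- Multiplication by `F`, compressed to the subspace `W`. -/
noncomputable def compressedMul {V : Type*} [Fintype V]
    (W : Submodule ℝ (EuclideanSpace ℝ V)) (F : V → ℝ) : W →ₗ[ℝ] W :=
  (W.orthogonalProjectionOnto : EuclideanSpace ℝ V →ₗ[ℝ] W) ∘ₗ
    (WithLp.linearEquiv 2 ℝ (V → ℝ)).symm ∘ₗ LinearMap.mulLeft ℝ F ∘ₗ
      (WithLp.linearEquiv 2 ℝ (V → ℝ)) ∘ₗ W.subtype

theorem inner_compressedMul {V : Type*} [Fintype V]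
    (W : Submodule ℝ (EuclideanSpace ℝ V)) (F : V → ℝ) (x y : W) :
    inner ℝ (compressedMul W F x) y =
      ∑ g, F g * (x : EuclideanSpace ℝ V) g * (y : EuclideanSpace ℝ V) g := by
  change inner ℝ (W.orthogonalProjectionOnto _) y = _
  rw [Submodule.inner_orthogonalProjectionOnto_eq_of_mem_right, PiLp.inner_apply]
  refine Finset.sum_congr rfl fun g _ => ?_
  simp
  ring

theorem isSymmetric_compressedMul {V : Type*} [Fintype V]
    (W : Submodule ℝ (EuclideanSpace ℝ V)) (F : V → ℝ) :
    (compressedMul W F).IsSymmetric := fun x y => by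
  rw [inner_compressedMul, real_inner_comm, inner_compressedMul]
  exact Finset.sum_congr rfl fun g _ => by ring

section LeftInvariant

variable {G : Type*} [Group G] [Fintype G]

/-- Left translation on `ℓ²(G)`, sending `φ` to `fun y => φ (g⁻¹ * y)`. It commutes with the
adjacency operator, which acts by right multiplication. -/
noncomputable def leftTranslation (𝕜 : Type*) [RCLike 𝕜] (g : G) :
    EuclideanSpace 𝕜 G ≃ₗᵢ[𝕜] EuclideanSpace 𝕜 G :=
  LinearIsometryEquiv.piLpCongrLeft 2 𝕜 𝕜 (Equiv.mulLeft g)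

@[simp]
theorem leftTranslation_apply {𝕜 : Type*} [RCLike 𝕜] (g : G) (x : EuclideanSpace 𝕜 G) (y : G) :
    leftTranslation 𝕜 g x y = x (g⁻¹ * y) := rfl

/-- A subspace of `ℓ²(G)` stable under all left translations. -/
def IsLeftInvariant {𝕜 : Type*} [RCLike 𝕜] (X : Submodule 𝕜 (EuclideanSpace 𝕜 G)) : Prop :=
  ∀ g, ∀ x ∈ X, leftTranslation 𝕜 g x ∈ X

theorem IsLeftInvariant.starProjection_leftTranslation {W : Submodule ℝ (EuclideanSpace ℝ G)}
    (hW : IsLeftInvariant W) (g : G) (v : EuclideanSpace ℝ G) :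
    W.starProjection (leftTranslation ℝ g v) = leftTranslation ℝ g (W.starProjection v) := by
  refine Submodule.eq_starProjection_of_mem_of_inner_eq_zero
    (hW g _ (W.starProjection_apply_mem v)) fun w hw => ?_
  have h1 : w = leftTranslation ℝ g (leftTranslation ℝ g⁻¹ w) := by ext y; simp
  rw [← map_sub, h1, LinearIsometryEquiv.inner_map_map]
  exact W.starProjection_inner_eq_zero v _ (hW _ _ hw)

/-- The diagonal of the reproducing kernel of a left-invariant subspace is constant. -/
theorem IsLeftInvariant.sum_sq_apply {W : Submodule ℝ (EuclideanSpace ℝ G)}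
    (hW : IsLeftInvariant W) {ι : Type*} [Fintype ι] (b : OrthonormalBasis ι ℝ W) (g : G) :
    ∑ i, (b i : EuclideanSpace ℝ G) g ^ 2 = (Fintype.card ι : ℝ) / Fintype.card G := by
  classical
  have h1 : ∀ g, ∑ i, (b i : EuclideanSpace ℝ G) g ^ 2 =
      ‖W.starProjection (EuclideanSpace.single g (1 : ℝ))‖ ^ 2 := fun g => by
    have := b.sum_sq_norm_inner_right (W.orthogonalProjectionOnto (EuclideanSpace.single g (1 : ℝ)))
    rw [W.starProjection_apply, Submodule.norm_coe, ← this]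
    refine Finset.sum_congr rfl fun i _ => ?_
    rw [Submodule.inner_orthogonalProjectionOnto_eq_of_mem_left, Real.norm_eq_abs, sq_abs,
      EuclideanSpace.inner_single_right]
    simp
  have h2 : ∀ g, ∑ i, (b i : EuclideanSpace ℝ G) g ^ 2 =
      ∑ i, (b i : EuclideanSpace ℝ G) 1 ^ 2 := fun g => by
    have h3 : EuclideanSpace.single g (1 : ℝ) =
        leftTranslation ℝ g (EuclideanSpace.single 1 (1 : ℝ)) := by
      ext y
      simp only [leftTranslation_apply, PiLp.single_apply]
      exact if_congr (by rw [inv_mul_eq_one, eq_comm]) rfl rfl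
    rw [h1, h1, h3, hW.starProjection_leftTranslation, LinearIsometryEquiv.norm_map]
  have h4 : ∑ g, ∑ i, (b i : EuclideanSpace ℝ G) g ^ 2 = Fintype.card ι := by
    rw [Finset.sum_comm]
    have : ∀ i, ∑ g, (b i : EuclideanSpace ℝ G) g ^ 2 = 1 := fun i => by
      rw [← EuclideanSpace.real_norm_sq_eq, Submodule.norm_coe, b.orthonormal.1 i, one_pow]
    simp [this]
  have hc : (Fintype.card G : ℝ) ≠ 0 := Nat.cast_ne_zero.2 Fintype.card_ne_zero
  rw [eq_div_iff hc, ← h4, Finset.sum_congr rfl fun g _ => h2 g, h2 g]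
  simp [mul_comm]

theorem IsLeftInvariant.sum_inner_compressedMul {W : Submodule ℝ (EuclideanSpace ℝ G)}
    (hW : IsLeftInvariant W) {ι : Type*} [Fintype ι] (b : OrthonormalBasis ι ℝ W) (F : G → ℝ) :
    ∑ i, inner ℝ (compressedMul W F (b i)) (b i) =
      (Fintype.card ι : ℝ) / Fintype.card G * ∑ g, F g := by
  simp only [inner_compressedMul]
  rw [Finset.sum_comm, Finset.mul_sum]
  refine Finset.sum_congr rfl fun g _ => ?_
  rw [← hW.sum_sq_apply b g, Finset.sum_mul]
  exact Finset.sum_congr rfl fun i _ => by ring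

/-- By Cauchy–Schwarz, `(∑ F b²)² ≤ ∑ F² b²` for a unit vector `b`; the sum of the right-hand
sides over a basis is determined by the constant diagonal of the reproducing kernel. -/
theorem IsLeftInvariant.sum_sq_inner_compressedMul_le {W : Submodule ℝ (EuclideanSpace ℝ G)}
    (hW : IsLeftInvariant W) {ι : Type*} [Fintype ι] (b : OrthonormalBasis ι ℝ W) (F : G → ℝ) :
    ∑ i, inner ℝ (compressedMul W F (b i)) (b i) ^ 2 ≤
      (Fintype.card ι : ℝ) / Fintype.card G * ∑ g, F g ^ 2 := by
  have h1 : ∀ i, inner ℝ (compressedMul W F (b i)) (b i) ^ 2 ≤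
      inner ℝ (compressedMul W (fun g => F g ^ 2) (b i)) (b i) := fun i => by
    have hn : ∑ g, (b i : EuclideanSpace ℝ G) g ^ 2 = 1 := by
      rw [← EuclideanSpace.real_norm_sq_eq, Submodule.norm_coe, b.orthonormal.1 i, one_pow]
    have := Finset.sum_mul_sq_le_sq_mul_sq Finset.univ
      (fun g => F g * (b i : EuclideanSpace ℝ G) g) (fun g => (b i : EuclideanSpace ℝ G) g)
    rw [hn, mul_one] at this
    rw [inner_compressedMul, inner_compressedMul]
    refine this.trans (le_of_eq ?_)
    exact Finset.sum_congr rfl fun g _ => by ring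
  exact (Finset.sum_le_sum fun i _ => h1 i).trans (hW.sum_inner_compressedMul b _).le

/-- `φ` satisfies the equidistribution bound for the test function `f` with factor `t`. -/
def IsEquidistributed (t : ℝ) (f : G → ℝ) (φ : EuclideanSpace ℝ G) : Prop :=
  |∑ g, φ g ^ 2 * f g - (∑ g, f g) / (Fintype.card G : ℝ)| ≤
    t * (‖WithLp.toLp 2 f‖ / √(Fintype.card G : ℝ))

/-- A bound for the probability that a uniform unit vector of a `D`-dimensional left-invariant
space fails the equidistribution bound with factor `t`. -/
noncomputable def tailBound (t D : ℝ) : ℝ :=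
  2 * Real.exp (1 / 8) * Real.exp (-(t * √D / 8)) + Real.exp (-(D / 12))

/-- For `F j` the test function `f j` minus its mean, the compression of multiplication by `F j`
to `W` is traceless with Hilbert–Schmidt norm at most `‖f j‖ * √(dim W / |G|)`. A unit vector of
`W` outside the corresponding cones is equidistributed, and a random basis avoids them all. -/
theorem IsLeftInvariant.exists_orthonormalBasis_isEquidistributed
    {W : Submodule ℝ (EuclideanSpace ℝ G)} (hW : IsLeftInvariant W) [Nontrivial W] {M : ℕ}
    (f : Fin M → G → ℝ) {t : ℝ} (ht : 0 ≤ t)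
    (hlt : (Module.finrank ℝ W : ℝ) * (M * tailBound t (Module.finrank ℝ W)) < 1) :
    ∃ b : OrthonormalBasis (Fin (Module.finrank ℝ W)) ℝ W,
      ∀ k j, IsEquidistributed t (f j) (b k) := by
  have hc : (0 : ℝ) < Fintype.card G := Nat.cast_pos.2 Fintype.card_pos
  have hD : (0 : ℝ) < Module.finrank ℝ W := Nat.cast_pos.2 Module.finrank_pos
  let F : Fin M → G → ℝ := fun j g => f j g - (∑ g, f j g) / (Fintype.card G : ℝ)
  have hF0 : ∀ j, ∑ g, F j g = 0 := fun j => by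
    simp only [F, Finset.sum_sub_distrib, Finset.sum_const, Finset.card_univ, nsmul_eq_mul]
    field_simp
    ring
  have hF2 : ∀ j, ∑ g, F j g ^ 2 ≤ ‖WithLp.toLp 2 (f j)‖ ^ 2 := fun j => by
    rw [EuclideanSpace.real_norm_sq_eq]
    have h1 : ∑ g, f j g ^ 2 = ∑ g, F j g ^ 2 + 2 * ((∑ g, f j g) / (Fintype.card G : ℝ)) *
        ∑ g, F j g + ∑ _g : G, ((∑ g, f j g) / (Fintype.card G : ℝ)) ^ 2 := by
      rw [Finset.mul_sum, ← Finset.sum_add_distrib, ← Finset.sum_add_distrib]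
      exact Finset.sum_congr rfl fun g _ => by simp only [F]; ring
    change _ ≤ ∑ g, f j g ^ 2
    rw [h1, hF0, mul_zero, add_zero]
    exact le_add_of_nonneg_right (Finset.sum_nonneg fun _ _ => sq_nonneg _)
  let H : Fin M → ℝ := fun j =>
    ‖WithLp.toLp 2 (f j)‖ * √((Module.finrank ℝ W : ℝ) / Fintype.card G)
  let C : Fin M → Set W := fun j =>
    quadraticCone (compressedMul W (F j)) (t * H j / √(Module.finrank ℝ W))
  have hCγ : ∀ j, (ProbabilityTheory.stdGaussian W).real (C j) ≤
      tailBound t (Module.finrank ℝ W) := fun j => by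
    refine stdGaussian_real_cone_le (isSymmetric_compressedMul W (F j)) (by positivity) ht
      (fun b => by rw [hW.sum_inner_compressedMul, hF0, mul_zero]) fun b => ?_
    refine (hW.sum_sq_inner_compressedMul_le b (F j)).trans ?_
    rw [Fintype.card_fin, mul_pow, Real.sq_sqrt (by positivity), mul_comm]
    exact mul_le_mul_of_nonneg_right (hF2 j) (by positivity)
  have hcone : ∀ (r : ℝ) x, r ≠ 0 → (r • x ∈ ⋃ j, C j ↔ x ∈ ⋃ j, C j) := fun r x hr => by
    simp only [Set.mem_iUnion, C]
    exact exists_congr fun j => smul_mem_quadraticCone_iff hr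
  obtain ⟨b, hb⟩ := exists_orthonormalBasis_forall_notMem
    (MeasurableSet.iUnion fun j => measurableSet_quadraticCone _ _) hcone (by
    refine lt_of_le_of_lt (mul_le_mul_of_nonneg_left ?_ hD.le) hlt
    refine (measureReal_iUnion_fintype_le _).trans ((Finset.sum_le_sum fun j _ => hCγ j).trans ?_)
    simp)
  refine ⟨b, fun k j => ?_⟩
  have h1 : b k ∉ C j := fun h => hb k (Set.mem_iUnion.2 ⟨j, h⟩)
  have hn : ∑ g, (b k : EuclideanSpace ℝ G) g ^ 2 = 1 := by
    rw [← EuclideanSpace.real_norm_sq_eq, Submodule.norm_coe, b.orthonormal.1 k, one_pow]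
  simp only [C, quadraticCone, Set.mem_ofPred_eq, not_lt, inner_compressedMul, b.orthonormal.1 k,
    one_pow, mul_one] at h1
  have h2 : ∑ g, F j g * (b k : EuclideanSpace ℝ G) g * (b k : EuclideanSpace ℝ G) g =
      ∑ g, (b k : EuclideanSpace ℝ G) g ^ 2 * f j g -
        (∑ g, f j g) / (Fintype.card G : ℝ) := by
    have : (∑ g, f j g) / (Fintype.card G : ℝ) = ∑ g, (b k : EuclideanSpace ℝ G) g ^ 2 *
        ((∑ g, f j g) / (Fintype.card G : ℝ)) := by rw [← Finset.sum_mul, hn, one_mul]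
    rw [this, ← Finset.sum_sub_distrib]
    exact Finset.sum_congr rfl fun g _ => by simp only [F]; ring
  rw [h2] at h1
  refine h1.trans (le_of_eq ?_)
  simp only [H]
  rw [Real.sqrt_div hD.le]
  have := (Real.sqrt_pos.2 hD).ne'
  field_simp

end LeftInvariant

/-! ### Real and complex function spaces -/

section Complexification

variable {V : Type*}

/-- The real part of a complex function. -/
noncomputable def rePart : EuclideanSpace ℂ V →ₗ[ℝ] EuclideanSpace ℝ V where
  toFun φ := WithLp.toLp 2 fun g => (φ g).re
  map_add' φ ψ := by ext g; simp
  map_smul' r φ := by ext g; simp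

@[simp]
theorem rePart_apply (φ : EuclideanSpace ℂ V) (g : V) : rePart φ g = (φ g).re := rfl

/-- A real function, regarded as a complex one. -/
noncomputable def ofRealFun : EuclideanSpace ℝ V →ₗ[ℝ] EuclideanSpace ℂ V where
  toFun x := WithLp.toLp 2 fun g => (x g : ℂ)
  map_add' x y := by ext g; simp
  map_smul' r x := by ext g; simp

@[simp]
theorem ofRealFun_apply (x : EuclideanSpace ℝ V) (g : V) : ofRealFun x g = (x g : ℂ) := rfl

theorem ofRealFun_rePart_add (φ : EuclideanSpace ℂ V) :
    ofRealFun (rePart φ) + Complex.I • ofRealFun (rePart (-Complex.I • φ)) = φ := by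
  ext g
  simp [mul_comm Complex.I, Complex.re_add_im]

/-- The complexification of a space `Y` of real functions: the functions whose real and imaginary
parts lie in `Y`. The imaginary part is encoded through the real part of `I • φ`. -/
noncomputable def complexification (Y : Submodule ℝ (EuclideanSpace ℝ V)) :
    Submodule ℂ (EuclideanSpace ℂ V) where
  carrier := {φ | rePart φ ∈ Y ∧ rePart (Complex.I • φ) ∈ Y}
  zero_mem' := by simp
  add_mem' := fun {φ ψ} hφ hψ => by
    refine ⟨?_, ?_⟩
    · rw [map_add]; exact Y.add_mem hφ.1 hψ.1
    · rw [smul_add, map_add]; exact Y.add_mem hφ.2 hψ.2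
  smul_mem' := fun c φ hφ => by
    have h1 : rePart (c • φ) = c.re • rePart φ + c.im • rePart (Complex.I • φ) := by
      ext g; simp; ring
    have h2 : rePart (Complex.I • c • φ) = c.re • rePart (Complex.I • φ) - c.im • rePart φ := by
      ext g; simp; ring
    exact ⟨by rw [h1]; exact Y.add_mem (Y.smul_mem _ hφ.1) (Y.smul_mem _ hφ.2),
      by rw [h2]; exact Y.sub_mem (Y.smul_mem _ hφ.2) (Y.smul_mem _ hφ.1)⟩

theorem ofRealFun_mem_complexification {Y : Submodule ℝ (EuclideanSpace ℝ V)}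
    {x : EuclideanSpace ℝ V} (hx : x ∈ Y) : ofRealFun x ∈ complexification Y := by
  have h1 : rePart (ofRealFun x) = x := by ext g; simp
  have h2 : rePart (Complex.I • ofRealFun x) = 0 := by ext g; simp
  exact ⟨by rwa [h1], by rw [h2]; exact Y.zero_mem⟩

/-- The space of real parts of the elements of `U`. -/
noncomputable def reSpace (U : Submodule ℂ (EuclideanSpace ℂ V)) :
    Submodule ℝ (EuclideanSpace ℝ V) :=
  (U.restrictScalars ℝ).map rePart

theorem rePart_mem_reSpace {U : Submodule ℂ (EuclideanSpace ℂ V)} {φ : EuclideanSpace ℂ V}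
    (hφ : φ ∈ U) : rePart φ ∈ reSpace U := Submodule.mem_map_of_mem hφ

theorem reSpace_le {U : Submodule ℂ (EuclideanSpace ℂ V)} {Y : Submodule ℝ (EuclideanSpace ℝ V)}
    (h : U ≤ complexification Y) : reSpace U ≤ Y := by
  rintro _ ⟨φ, hφ, rfl⟩
  exact (h hφ).1

variable [Fintype V]

theorem inner_ofRealFun (x y : EuclideanSpace ℝ V) :
    inner ℂ (ofRealFun x) (ofRealFun y) = (inner ℝ x y : ℂ) := by
  simp [PiLp.inner_apply]

theorem Orthonormal.ofRealFun {ι : Type*} {v : ι → EuclideanSpace ℝ V} (hv : Orthonormal ℝ v) :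
    Orthonormal ℂ fun i => ofRealFun (v i) := by
  classical
  rw [orthonormal_iff_ite] at hv ⊢
  intro i j
  rw [inner_ofRealFun, hv]
  split_ifs <;> simp

theorem finrank_reSpace_le (U : Submodule ℂ (EuclideanSpace ℂ V)) :
    Module.finrank ℝ (reSpace U) ≤ 2 * Module.finrank ℂ U := by
  rw [← finrank_real_of_complex]
  exact Submodule.finrank_map_le rePart (U.restrictScalars ℝ)

theorem finrank_le_finrank_reSpace (U : Submodule ℂ (EuclideanSpace ℂ V)) :
    Module.finrank ℂ U ≤ Module.finrank ℝ (reSpace U) := by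
  let b := Module.finBasis ℝ (reSpace U)
  let v := fun i => ofRealFun (b i : EuclideanSpace ℝ V)
  have h1 : ∀ x ∈ reSpace U, ofRealFun x ∈ Submodule.span ℂ (Set.range v) := by
    intro x hx
    have h2 := congrArg (fun y : reSpace U => ofRealFun (y : EuclideanSpace ℝ V))
      (b.sum_repr ⟨x, hx⟩)
    simp only [AddSubmonoidClass.coe_finsetSum, Submodule.coe_smul, map_sum, map_smul] at h2
    rw [← h2]
    refine Submodule.sum_mem _ fun i _ => ?_
    rw [← Complex.coe_smul]
    exact Submodule.smul_mem _ _ (Submodule.subset_span ⟨i, rfl⟩)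
  have h2 : U ≤ Submodule.span ℂ (Set.range v) := fun φ hφ => by
    rw [← ofRealFun_rePart_add φ]
    exact Submodule.add_mem _ (h1 _ (rePart_mem_reSpace hφ))
      (Submodule.smul_mem _ _ (h1 _ (rePart_mem_reSpace (U.smul_mem _ hφ))))
  refine (Submodule.finrank_mono h2).trans ?_
  simpa using! finrank_range_le_card (R := ℂ) v

end Complexification

/-! ### Irreducible constituents -/

section Constituents

variable {G : Type*} [Group G] [Fintype G]

theorem isLeftInvariant_complexification {Y : Submodule ℝ (EuclideanSpace ℝ G)}
    (hY : IsLeftInvariant Y) : IsLeftInvariant (complexification Y) := fun g φ hφ =>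
  ⟨hY g _ hφ.1, by rw [← map_smul]; exact hY g _ hφ.2⟩

theorem isLeftInvariant_reSpace {U : Submodule ℂ (EuclideanSpace ℂ G)}
    (hU : IsLeftInvariant U) : IsLeftInvariant (reSpace U) := by
  rintro g _ ⟨φ, hφ, rfl⟩
  exact rePart_mem_reSpace (hU g φ hφ)

/-- Left translation on a left-invariant subspace. -/
noncomputable def IsLeftInvariant.translation {U : Submodule ℂ (EuclideanSpace ℂ G)}
    (hU : IsLeftInvariant U) (g : G) : U ≃ₗᵢ[ℂ] U where
  toFun x := ⟨leftTranslation ℂ g x, hU g x x.2⟩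
  invFun x := ⟨leftTranslation ℂ g⁻¹ x, hU g⁻¹ x x.2⟩
  map_add' x y := by ext; simp
  map_smul' c x := by ext; simp
  left_inv x := by ext; simp
  right_inv x := by ext; simp
  norm_map' x := (leftTranslation ℂ g).norm_map x

@[simp]
theorem IsLeftInvariant.coe_translation_apply {U : Submodule ℂ (EuclideanSpace ℂ G)}
    (hU : IsLeftInvariant U) (g : G) (x : U) :
    (hU.translation g x : EuclideanSpace ℂ G) = leftTranslation ℂ g x := rfl

/-- The left translation representation on a left-invariant subspace, in orthonormal
coordinates. -/
noncomputable def IsLeftInvariant.unitaryRep {U : Submodule ℂ (EuclideanSpace ℂ G)}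
    (hU : IsLeftInvariant U) : UnitaryRep G where
  dim := Module.finrank ℂ U
  hom :=
    { toFun g := ((stdOrthonormalBasis ℂ U).repr.symm.trans (hU.translation g)).trans
        (stdOrthonormalBasis ℂ U).repr
      map_one' := by
        ext1 v
        have : ∀ x, hU.translation 1 x = x := fun x => by
          ext y; simp
        simp [this]
      map_mul' g h := by
        ext1 v
        have : ∀ x, hU.translation (g * h) x = hU.translation g (hU.translation h x) := fun x => by
          ext y; simp [mul_assoc]
        simp [this] }

theorem IsLeftInvariant.unitaryRep_hom_apply {U : Submodule ℂ (EuclideanSpace ℂ G)}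
    (hU : IsLeftInvariant U) (g : G) (v : EuclideanSpace ℂ (Fin (Module.finrank ℂ U))) :
    hU.unitaryRep.hom g v = (stdOrthonormalBasis ℂ U).repr
      (hU.translation g ((stdOrthonormalBasis ℂ U).repr.symm v)) := rfl

/-- The embedding of the coordinate space of `hU.unitaryRep` into `ℓ²(G)`. -/
noncomputable def IsLeftInvariant.embedding {U : Submodule ℂ (EuclideanSpace ℂ G)}
    (hU : IsLeftInvariant U) :
    EuclideanSpace ℂ (Fin hU.unitaryRep.dim) →ₗ[ℂ] EuclideanSpace ℂ G :=
  U.subtype ∘ₗ (stdOrthonormalBasis ℂ U).repr.symm.toLinearEquiv.toLinearMap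

theorem IsLeftInvariant.embedding_injective {U : Submodule ℂ (EuclideanSpace ℂ G)}
    (hU : IsLeftInvariant U) : Function.Injective hU.embedding :=
  U.subtype_injective.comp (stdOrthonormalBasis ℂ U).repr.symm.injective

theorem IsLeftInvariant.range_embedding {U : Submodule ℂ (EuclideanSpace ℂ G)}
    (hU : IsLeftInvariant U) : LinearMap.range hU.embedding = U :=
  (LinearMap.range_comp_of_range_eq_top _ (LinearEquiv.range _)).trans U.range_subtype

theorem IsLeftInvariant.embedding_hom {U : Submodule ℂ (EuclideanSpace ℂ G)}
    (hU : IsLeftInvariant U) (g : G) (v : EuclideanSpace ℂ (Fin hU.unitaryRep.dim)) :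
    hU.embedding (hU.unitaryRep.hom g v) = leftTranslation ℂ g (hU.embedding v) :=
  congrArg (fun x : U => (x : EuclideanSpace ℂ G))
    ((stdOrthonormalBasis ℂ U).repr.symm_apply_apply _)

/-- A minimal nonzero left-invariant subspace carries an irreducible representation. -/
noncomputable def IsLeftInvariant.unitaryIrrep {U : Submodule ℂ (EuclideanSpace ℂ G)}
    (hU : IsLeftInvariant U) (h0 : U ≠ ⊥)
    (hmin : ∀ U' ≤ U, IsLeftInvariant U' → U' = ⊥ ∨ U' = U) : UnitaryIrrep G where
  toUnitaryRep := hU.unitaryRep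
  irreducible := by
    have hj := Submodule.map_injective_of_injective hU.embedding_injective
    have htop : (⊤ : Submodule ℂ _).map hU.embedding = U :=
      (LinearMap.range_eq_map _).symm.trans hU.range_embedding
    refine { exists_pair_ne := ⟨⊥, ⊤, fun h => h0 ?_⟩, eq_bot_or_eq_top := fun P => ?_ }
    · have h1 : (⊥ : Submodule ℂ (EuclideanSpace ℂ (Fin hU.unitaryRep.dim))) = ⊤ :=
        congrArg Subrepresentation.toSubmodule h
      exact (htop.symm.trans (congrArg _ h1.symm)).trans (Submodule.map_bot _)
    · have h1 : P.toSubmodule.map hU.embedding ≤ U :=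
        LinearMap.map_le_range.trans hU.range_embedding.le
      have h2 : IsLeftInvariant (P.toSubmodule.map hU.embedding) := by
        rintro g _ ⟨v, hv, rfl⟩
        exact ⟨_, P.apply_mem_toSubmodule g hv, hU.embedding_hom g v⟩
      exact (hmin _ h1 h2).imp
        (fun h => Subrepresentation.toSubmodule_injective
          (hj (h.trans (Submodule.map_bot hU.embedding).symm)))
        (fun h => Subrepresentation.toSubmodule_injective (hj (h.trans htop.symm)))

/-- If the representation is trivial, then the subspace consists of constant functions. -/
theorem IsLeftInvariant.apply_eq_of_unitaryIrrep_equiv_triv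
    {U : Submodule ℂ (EuclideanSpace ℂ G)} (hU : IsLeftInvariant U) (h0 : U ≠ ⊥)
    (hmin : ∀ U' ≤ U, IsLeftInvariant U' → U' = ⊥ ∨ U' = U)
    (h : hU.unitaryIrrep h0 hmin ≈ UnitaryIrrep.triv G) {φ : EuclideanSpace ℂ G} (hφ : φ ∈ U)
    (g : G) : φ g = φ 1 := by
  obtain ⟨T, hT⟩ := h
  have h1 : ∀ g v, hU.unitaryRep.hom g v = v := fun g v => T.injective (hT g v)
  have h2 := h1 g⁻¹ ((stdOrthonormalBasis ℂ U).repr ⟨φ, hφ⟩)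
  rw [hU.unitaryRep_hom_apply, LinearIsometryEquiv.symm_apply_apply] at h2
  have h3 := congrArg (fun x : U => (x : EuclideanSpace ℂ G) 1)
    ((stdOrthonormalBasis ℂ U).repr.injective h2)
  simpa using h3

/-- Every nonzero left-invariant space `Y` of real functions contains one, namely the real parts
of an irreducible subspace `U` of its complexification, that consists of constants or whose
dimension is between `dim U` and `2 * dim U` with `U` nontrivial. -/
theorem IsLeftInvariant.exists_le_finrank {Y : Submodule ℝ (EuclideanSpace ℝ G)}
    (hY : IsLeftInvariant Y) (h0 : Y ≠ ⊥) :
    ∃ W ≤ Y, W ≠ ⊥ ∧ IsLeftInvariant W ∧ ((∀ x ∈ W, ∀ g, x g = x 1) ∨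
      ∃ c : UnitaryDual G, c ≠ UnitaryDual.triv G ∧ c.dim ≤ Module.finrank ℝ W ∧
        Module.finrank ℝ W ≤ 2 * c.dim) := by
  have hne : ({U | U ≠ ⊥ ∧ IsLeftInvariant U ∧ U ≤ complexification Y} :
      Set (Submodule ℂ (EuclideanSpace ℂ G))).Nonempty := by
    refine ⟨complexification Y, fun h => h0 ?_, isLeftInvariant_complexification hY, le_rfl⟩
    rw [Submodule.eq_bot_iff]
    intro x hx
    have h1 := ofRealFun_mem_complexification hx
    rw [h, Submodule.mem_bot] at h1
    ext g
    simpa using congrArg (fun φ : EuclideanSpace ℂ G => φ g) h1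
  obtain ⟨U, ⟨hU0, hU, hUY⟩, hUmin⟩ := WellFounded.has_min
    (wellFounded_lt (α := Submodule ℂ (EuclideanSpace ℂ G))) _ hne
  have hmin : ∀ U' ≤ U, IsLeftInvariant U' → U' = ⊥ ∨ U' = U := fun U' hle hinv => by
    by_contra! hcon
    exact hUmin U' ⟨hcon.1, hinv, hle.trans hUY⟩ (lt_of_le_of_ne hle hcon.2)
  have hdim := finrank_le_finrank_reSpace U
  refine ⟨reSpace U, reSpace_le hUY, fun h => hU0 ?_, isLeftInvariant_reSpace hU, ?_⟩
  · rw [h, finrank_bot] at hdim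
    exact Submodule.finrank_eq_zero.1 (Nat.le_zero.1 hdim)
  · by_cases hc : (⟦hU.unitaryIrrep hU0 hmin⟧ : UnitaryDual G) = UnitaryDual.triv G
    · left
      rintro _ ⟨φ, hφ, rfl⟩ g
      simp only [rePart_apply]
      rw [hU.apply_eq_of_unitaryIrrep_equiv_triv hU0 hmin (Quotient.exact hc) hφ]
    · exact Or.inr ⟨_, hc, hdim, finrank_reSpace_le U⟩

end Constituents

/-! ### The adjacency operator on real functions -/

section RealAdjacency

variable {G : Type*} [Group G] [Fintype G]

open Classical in
/-- The adjacency operator of `Cay(G, S)` on real functions. -/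
noncomputable def realAdjacency (S : Set G) : EuclideanSpace ℝ G →ₗ[ℝ] EuclideanSpace ℝ G where
  toFun x := WithLp.toLp 2 fun g => ∑ s ∈ S.toFinset, x (g * s)
  map_add' x y := by ext g; simp [Finset.sum_add_distrib]
  map_smul' r x := by ext g; simp [Finset.mul_sum]

open Classical in
theorem realAdjacency_apply (S : Set G) (x : EuclideanSpace ℝ G) (g : G) :
    realAdjacency S x g = ∑ s ∈ S.toFinset, x (g * s) := rfl

theorem adjacencyOperator_ofRealFun (S : Set G) (x : EuclideanSpace ℝ G) :
    adjacencyOperator S (ofRealFun x) = ofRealFun (realAdjacency S x) := by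
  ext g
  simp [adjacencyOperator_apply, realAdjacency_apply]

theorem realAdjacency_leftTranslation (S : Set G) (g : G) (x : EuclideanSpace ℝ G) :
    realAdjacency S (leftTranslation ℝ g x) = leftTranslation ℝ g (realAdjacency S x) := by
  ext y
  simp [realAdjacency_apply, mul_assoc]

theorem isSymmetric_realAdjacency {S : Set G} (hS : S⁻¹ = S) : (realAdjacency S).IsSymmetric := by
  classical
  intro x y
  simp only [PiLp.inner_apply, realAdjacency_apply, RCLike.inner_apply, conj_trivial,
    Finset.mul_sum, Finset.sum_mul]
  rw [Finset.sum_comm, Finset.sum_comm (s := Finset.univ)]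
  refine Finset.sum_nbij' (fun s => s⁻¹) (fun s => s⁻¹) ?_ ?_ ?_ ?_ ?_
  · intro s hs
    rw [Set.mem_toFinset] at hs ⊢
    rwa [← hS, Set.inv_mem_inv]
  · intro s hs
    rw [Set.mem_toFinset] at hs ⊢
    rwa [← hS, Set.inv_mem_inv]
  · simp
  · simp
  · intro s _
    exact Fintype.sum_equiv (Equiv.mulRight s) _ _ fun g => by simp

theorem isCayleyEigenfunction_ofRealFun {S : Set G} {x : EuclideanSpace ℝ G} {lam : ℝ}
    (hx : realAdjacency S x = lam • x) (h0 : ofRealFun x ≠ 0) :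
    IsCayleyEigenfunction S (ofRealFun x) := by
  refine ⟨lam, Module.End.mem_eigenspace_iff.2 ?_, h0⟩
  rw [adjacencyOperator_ofRealFun, hx, map_smul, Complex.coe_smul]

/-- A nonzero space of real functions stable under left translations and the adjacency operator
contains a nonzero left-invariant space of eigenfunctions, since the two commute. -/
theorem exists_eigenspace_le {S : Set G} (hS : S⁻¹ = S) {X : Submodule ℝ (EuclideanSpace ℝ G)}
    (hX : IsLeftInvariant X) (hA : ∀ x ∈ X, realAdjacency S x ∈ X) (h0 : X ≠ ⊥) :
    ∃ Y ≤ X, Y ≠ ⊥ ∧ IsLeftInvariant Y ∧ ∃ lam : ℝ, ∀ x ∈ Y, realAdjacency S x = lam • x := by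
  have : Nontrivial X := Submodule.nontrivial_iff_ne_bot.2 h0
  obtain ⟨lam, hlam⟩ : ∃ lam : ℝ, Module.End.HasEigenvalue ((realAdjacency S).restrict hA) lam :=
    ⟨_, ((isSymmetric_realAdjacency hS).restrict_invariant
      hA).hasEigenvalue_iSup_of_finiteDimensional⟩
  obtain ⟨v, hv⟩ := hlam.exists_hasEigenvector
  have hv1 : realAdjacency S v = lam • (v : EuclideanSpace ℝ G) :=
    congrArg (fun x : X => (x : EuclideanSpace ℝ G)) hv.apply_eq_smul
  refine ⟨X ⊓ Module.End.eigenspace (realAdjacency S) lam, inf_le_left, ?_, ?_, lam, ?_⟩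
  · intro h
    refine hv.2 (Subtype.ext ((Submodule.eq_bot_iff _).1 h v ⟨v.2, ?_⟩))
    exact Module.End.mem_eigenspace_iff.2 hv1
  · rintro g x ⟨hx, hx'⟩
    refine ⟨hX g x hx, Module.End.mem_eigenspace_iff.2 ?_⟩
    rw [realAdjacency_leftTranslation, Module.End.mem_eigenspace_iff.1 hx', map_smul]
  · rintro x ⟨-, hx⟩
    exact Module.End.mem_eigenspace_iff.1 hx

end RealAdjacency

/-! ### Assembling the basis -/

section Basis

variable {G : Type*} [Group G] [Fintype G]

/-- Orthonormal bases consisting of functions with a property `Q` can be glued, provided every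
invariant space contains an invariant subspace with such a basis. -/
theorem exists_orthonormal_of_forall_exists_le {S : Set G} (hS : S⁻¹ = S)
    {Q : EuclideanSpace ℝ G → Prop}
    (hQ : ∀ X : Submodule ℝ (EuclideanSpace ℝ G), IsLeftInvariant X →
      (∀ x ∈ X, realAdjacency S x ∈ X) → X ≠ ⊥ → ∃ W ≤ X, W ≠ ⊥ ∧ IsLeftInvariant W ∧
        (∀ x ∈ W, realAdjacency S x ∈ W) ∧
        ∃ b : OrthonormalBasis (Fin (Module.finrank ℝ W)) ℝ W, ∀ k, Q (b k))
    (n : ℕ) (X : Submodule ℝ (EuclideanSpace ℝ G)) (hn : Module.finrank ℝ X = n)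
    (hX : IsLeftInvariant X) (hA : ∀ x ∈ X, realAdjacency S x ∈ X) :
    ∃ (ι : Type) (_ : Fintype ι) (v : ι → EuclideanSpace ℝ G), Fintype.card ι = n ∧
      Orthonormal ℝ v ∧ ∀ k, v k ∈ X ∧ Q (v k) := by
  induction n using Nat.strong_induction_on generalizing X with
  | _ n ih =>
  by_cases h0 : X = ⊥
  · refine ⟨Empty, inferInstance, Empty.elim, ?_, ⟨fun i => i.elim, fun i => i.elim⟩,
      fun i => i.elim⟩
    rw [← hn, h0, finrank_bot]
    rfl
  obtain ⟨W, hWX, hW0, hW, hWA, b, hb⟩ := hQ X hX hA h0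
  have hadd := Submodule.finrank_add_inf_finrank_orthogonal hWX
  have hpos : 0 < Module.finrank ℝ W :=
    Nat.pos_of_ne_zero fun h => hW0 (Submodule.finrank_eq_zero.1 h)
  have hX' : IsLeftInvariant (Wᗮ ⊓ X) := by
    rintro g x ⟨hx, hx'⟩
    refine ⟨fun w hw => ?_, hX g x hx'⟩
    have h1 : w = leftTranslation ℝ g (leftTranslation ℝ g⁻¹ w) := by ext y; simp
    rw [h1, LinearIsometryEquiv.inner_map_map]
    exact hx _ (hW _ _ hw)
  have hA' : ∀ x ∈ Wᗮ ⊓ X, realAdjacency S x ∈ Wᗮ ⊓ X := by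
    rintro x ⟨hx, hx'⟩
    refine ⟨fun w hw => ?_, hA x hx'⟩
    rw [← isSymmetric_realAdjacency hS]
    exact hx _ (hWA _ hw)
  obtain ⟨ι, hι, v, hcard, hv, hvQ⟩ := ih (Module.finrank ℝ ↥(Wᗮ ⊓ X))
    (by rw [← hn, ← hadd]; exact Nat.lt_add_of_pos_left hpos) (Wᗮ ⊓ X) rfl hX' hA'
  have horth : ∀ i j, inner ℝ (b i : EuclideanSpace ℝ G) (v j) = 0 := fun i j =>
    (hvQ j).1.1 _ (b i).2
  have hbo := b.orthonormal.comp_linearIsometry W.subtypeₗᵢ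
  refine ⟨Fin (Module.finrank ℝ W) ⊕ ι, inferInstance,
    Sum.elim (fun i => (b i : EuclideanSpace ℝ G)) v, ?_, ⟨?_, ?_⟩, ?_⟩
  · rw [Fintype.card_sum, Fintype.card_fin, hcard, hadd, hn]
  · rintro (i | i)
    · exact hbo.1 i
    · exact hv.1 i
  · rintro (i | i) (j | j) hij
    · exact hbo.2 fun h => hij (congrArg _ h)
    · exact horth i j
    · exact (real_inner_comm _ _).trans (horth j i)
    · exact hv.2 fun h => hij (congrArg _ h)
  · rintro (i | i)
    · exact ⟨hWX (b i).2, hb i⟩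
    · exact ⟨(hvQ i).1.2, (hvQ i).2⟩

/-- The condition on `M` and `t` for one class `c`, in the form needed for a space of dimension
`D` between `dim c` and `2 * dim c`. -/
theorem mul_tailBound_lt_one {M : ℕ} {t : ℝ} (ht : 0 ≤ t)
    (hM : 2 * (M : ℝ) * ∑ c : UnitaryDual G with c ≠ UnitaryDual.triv G,
      (c.dim : ℝ) ^ 2 *
        (6 * Real.exp (-(t * √(c.dim : ℝ) / 64)) + 2 * Real.exp (-((c.dim : ℝ) / 12))) < 1)
    {c : UnitaryDual G} (hc : c ≠ UnitaryDual.triv G) {D : ℕ} (h1 : c.dim ≤ D)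
    (h2 : D ≤ 2 * c.dim) : (D : ℝ) * (M * tailBound t D) < 1 := by
  refine lt_of_le_of_lt ?_ hM
  have hle : (c.dim : ℝ) ≤ D := by exact_mod_cast h1
  have hle2 : (D : ℝ) ≤ 2 * c.dim := by exact_mod_cast h2
  have hdd : (c.dim : ℝ) ≤ (c.dim : ℝ) ^ 2 := by exact_mod_cast Nat.le_self_pow two_ne_zero _
  have htail : tailBound t D ≤
      6 * Real.exp (-(t * √(c.dim : ℝ) / 64)) + 2 * Real.exp (-((c.dim : ℝ) / 12)) := by
    have he : Real.exp (1 / 8) ≤ 3 := by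
      refine (Real.exp_le_exp.2 (by norm_num : (1 / 8 : ℝ) ≤ 1)).trans ?_
      linarith [Real.exp_one_lt_d9]
    have hs : t * √(c.dim : ℝ) ≤ t * √(D : ℝ) :=
      mul_le_mul_of_nonneg_left (Real.sqrt_le_sqrt hle) ht
    have hs0 : 0 ≤ t * √(c.dim : ℝ) := by positivity
    unfold tailBound
    refine add_le_add (mul_le_mul (by linarith) (Real.exp_le_exp.2 (by linarith))
      (Real.exp_pos _).le (by norm_num)) ?_
    have := Real.exp_le_exp.2 (by linarith : -((D : ℝ) / 12) ≤ -((c.dim : ℝ) / 12))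
    linarith [Real.exp_pos (-((c.dim : ℝ) / 12))]
  have hsingle := Finset.single_le_sum
    (s := Finset.univ.filter fun c : UnitaryDual G => c ≠ UnitaryDual.triv G)
    (f := fun c : UnitaryDual G => (c.dim : ℝ) ^ 2 *
      (6 * Real.exp (-(t * √(c.dim : ℝ) / 64)) + 2 * Real.exp (-((c.dim : ℝ) / 12))))
    (fun c _ => by positivity) (Finset.mem_filter.2 ⟨Finset.mem_univ c, hc⟩)
  have h0 : 0 ≤ tailBound t D := by unfold tailBound; positivity
  refine le_trans ?_ (mul_le_mul_of_nonneg_left hsingle (by positivity))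
  calc (D : ℝ) * (M * tailBound t D)
      ≤ (2 * (c.dim : ℝ) ^ 2) * (M * tailBound t D) :=
        mul_le_mul_of_nonneg_right (by linarith) (by positivity)
    _ = 2 * (M : ℝ) * ((c.dim : ℝ) ^ 2 * tailBound t D) := by ring
    _ ≤ _ := by gcongr

/-- A unit vector that is a constant function is perfectly equidistributed. -/
theorem isEquidistributed_of_apply_eq {t : ℝ} (ht : 0 ≤ t) (f : G → ℝ)
    {x : EuclideanSpace ℝ G} (hx : ∀ g, x g = x 1) (hn : ‖x‖ = 1) : IsEquidistributed t f x := by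
  have hc : (Fintype.card G : ℝ) ≠ 0 := Nat.cast_ne_zero.2 Fintype.card_ne_zero
  have h1 : (Fintype.card G : ℝ) * x 1 ^ 2 = 1 := by
    have := EuclideanSpace.real_norm_sq_eq x
    rw [hn, one_pow, Finset.sum_congr rfl fun g _ => by rw [hx g]] at this
    simpa using this.symm
  have h2 : ∑ g, x g ^ 2 * f g - (∑ g, f g) / (Fintype.card G : ℝ) = 0 := by
    rw [Finset.sum_congr rfl fun g _ => by rw [hx g], ← Finset.mul_sum, eq_div_of_mul_eq hc
      ((mul_comm _ _).trans h1)]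
    ring
  rw [IsEquidistributed, h2, abs_zero]
  positivity

/-- The theorem for a single graph. Each block produced by `IsLeftInvariant.exists_le_finrank`
inside an eigenspace receives its own random basis, so a union bound is only needed within a block
and the summand of a single class suffices. -/
theorem exists_orthonormalBasis_isCayleyEigenfunction {S : Set G} (hS : S⁻¹ = S) {t : ℝ}
    (ht : 0 < t) {M : ℕ}
    (hM : 2 * (M : ℝ) * ∑ c : UnitaryDual G with c ≠ UnitaryDual.triv G,
      (c.dim : ℝ) ^ 2 *
        (6 * Real.exp (-(t * √(c.dim : ℝ) / 64)) + 2 * Real.exp (-((c.dim : ℝ) / 12))) < 1)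
    (f : Fin M → G → ℝ) :
    ∃ B : OrthonormalBasis (Fin (Fintype.card G)) ℂ (EuclideanSpace ℂ G),
      (∀ k, (∀ g, (B k g).im = 0) ∧ IsCayleyEigenfunction S (B k)) ∧
      ∀ k j, |∫ g, f j g ∂(quantumMeasure (B k)) - (∑ g, f j g) / (Fintype.card G : ℝ)| ≤
        t * (‖WithLp.toLp 2 (f j)‖ / √(Fintype.card G : ℝ)) := by
  obtain ⟨ι, _, v, hcard, hv, hvQ⟩ := exists_orthonormal_of_forall_exists_le hS
    (Q := fun x => (∃ lam : ℝ, realAdjacency S x = lam • x) ∧ ∀ j, IsEquidistributed t (f j) x)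
    (by
      intro X hX hA h0
      obtain ⟨Y, hYX, hY0, hY, lam, hlam⟩ := exists_eigenspace_le hS hX hA h0
      obtain ⟨W, hWY, hW0, hW, hW'⟩ := hY.exists_le_finrank hY0
      have : Nontrivial W := Submodule.nontrivial_iff_ne_bot.2 hW0
      refine ⟨W, hWY.trans hYX, hW0, hW, fun x hx => ?_, ?_⟩
      · rw [hlam x (hWY hx)]
        exact W.smul_mem _ hx
      rcases hW' with hconst | ⟨c, hc, h1, h2⟩
      · refine ⟨stdOrthonormalBasis ℝ W, fun k => ⟨⟨lam, hlam _ (hWY (Subtype.prop _))⟩,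
          fun j => isEquidistributed_of_apply_eq ht.le _ (hconst _ (Subtype.prop _)) ?_⟩⟩
        exact (stdOrthonormalBasis ℝ W).orthonormal.1 k
      · obtain ⟨b, hb⟩ := hW.exists_orthonormalBasis_isEquidistributed f ht.le
          (mul_tailBound_lt_one ht.le hM hc h1 h2)
        exact ⟨b, fun k => ⟨⟨lam, hlam _ (hWY (Subtype.prop _))⟩, hb k⟩⟩)
    (Fintype.card G) ⊤ (by simp) (fun _ _ _ => Submodule.mem_top) (fun _ _ => Submodule.mem_top)
  let e := (Fintype.equivFinOfCardEq hcard).symm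
  have hon : Orthonormal ℂ fun k => ofRealFun (v (e k)) := (hv.comp e e.injective).ofRealFun
  have hspan : ⊤ ≤ Submodule.span ℂ (Set.range fun k => ofRealFun (v (e k))) :=
    (hon.linearIndependent.span_eq_top_of_card_eq_finrank' (by simp)).ge
  refine ⟨OrthonormalBasis.mk hon hspan, fun k => ?_, fun k j => ?_⟩
  · rw [OrthonormalBasis.coe_mk]
    obtain ⟨lam, hlam⟩ := (hvQ (e k)).2.1
    exact ⟨fun g => by simp, isCayleyEigenfunction_ofRealFun hlam (hon.ne_zero k)⟩
  · rw [OrthonormalBasis.coe_mk, integral_quantumMeasure]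
    simpa [IsEquidistributed] using (hvQ (e k)).2.2 j

end Basis

/-! ### Indicator functions -/

section Indicator

variable {V : Type*} [Fintype V]

theorem norm_toLp_indicator_one (A : Set V) :
    ‖WithLp.toLp 2 (A.indicator (1 : V → ℝ))‖ = √(A.ncard : ℝ) := by
  classical
  rw [EuclideanSpace.norm_eq]
  congr 1
  simp [Set.indicator_apply, Set.ncard_eq_toFinset_card']

theorem sum_indicator_one (A : Set V) : ∑ g, A.indicator (1 : V → ℝ) g = A.ncard := by
  classical
  simp [Set.indicator_apply, Set.ncard_eq_toFinset_card']

theorem integral_indicator_one_quantumMeasure (φ : EuclideanSpace ℂ V) (A : Set V) :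
    ∫ g, A.indicator (1 : V → ℝ) g ∂(quantumMeasure φ) = (quantumMeasure φ).real A := by
  let _ : MeasurableSpace V := ⊤
  exact integral_indicator_one trivial

end Indicator

/-- An error of relative size `√(t² n / a)` is negligible. When `a m = 0`, the hypothesis forces
`μ m = 0`, so empty sets need no exclusion. -/
theorem isEquivalent_div_of_abs_sub_le {μ t n a : ℕ → ℝ} (ht : ∀ m, 0 ≤ t m) (hn : ∀ m, 0 < n m)
    (ha : ∀ m, 0 ≤ a m) (h : ∀ m, |μ m - a m / n m| ≤ t m * (√(a m) / √(n m)))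
    (hlim : Tendsto (fun m => t m ^ 2 * n m / a m) atTop (𝓝 0)) :
    μ ~[atTop] fun m => a m / n m := by
  have hs : Tendsto (fun m => √(t m ^ 2 * n m / a m)) atTop (𝓝 0) := by
    simpa using hlim.sqrt
  refine IsLittleO.of_bound fun ε hε => ?_
  filter_upwards [hs.eventually_le_const hε] with m hm
  have hnm := hn m
  rw [Pi.sub_apply, Real.norm_eq_abs, Real.norm_of_nonneg (by have := ha m; positivity)]
  refine (h m).trans (le_trans (le_of_eq ?_)
    (mul_le_mul_of_nonneg_right hm (by have := ha m; positivity)))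
  rcases (ha m).eq_or_lt with h0 | h0
  · simp [← h0]
  · rw [Real.sqrt_div (by positivity), Real.sqrt_mul (by positivity), Real.sqrt_sq (ht m)]
    have h1 : √(a m) ^ 2 = a m := Real.sq_sqrt h0.le
    have h2 : √(n m) ^ 2 = n m := Real.sq_sqrt hnm.le
    have h3 : √(a m) ≠ 0 := (Real.sqrt_pos.2 h0).ne'
    have h4 : √(n m) ≠ 0 := (Real.sqrt_pos.2 hnm).ne'
    rw [← h1, ← h2, Real.sqrt_sq (Real.sqrt_nonneg _), Real.sqrt_sq (Real.sqrt_nonneg _)]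
    field_simp

theorem theorem1p1
    (G : ℕ → Type*) [∀ i, Group (G i)] [∀ i, Fintype (G i)]
    (hG : Tendsto (fun i => Fintype.card (G i)) atTop atTop)
    (S : ∀ i, Set (G i)) (hS : ∀ i, (S i)⁻¹ = S i)
    (t : ℕ → ℝ) (ht : ∀ i, 0 < t i)
    (M : ℕ → ℕ)
    (hM : ∀ i, 2 * (M i : ℝ) * ∑ c : UnitaryDual (G i) with c ≠ UnitaryDual.triv (G i),
      (c.dim : ℝ) ^ 2 *
        (6 * Real.exp (-(t i * √(c.dim : ℝ) / 64)) + 2 * Real.exp (-((c.dim : ℝ) / 12))) < 1)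
    (f : ∀ i, Fin (M i) → G i → ℝ) :
    ∃ B : ∀ i, OrthonormalBasis (Fin (Fintype.card (G i))) ℂ (EuclideanSpace ℂ (G i)),
      (∀ i k, (∀ g, (B i k g).im = 0) ∧ IsCayleyEigenfunction (S i) (B i k)) ∧
      (∀ i k j,
        |∫ g, f i j g ∂(quantumMeasure (B i k)) - (∑ g, f i j g) / (Fintype.card (G i) : ℝ)| ≤
          t i * (‖WithLp.toLp 2 (f i j)‖ / √(Fintype.card (G i) : ℝ))) ∧
      (∀ i k j (A : Set (G i)), f i j = A.indicator 1 →
        |(quantumMeasure (B i k)).real A - (A.ncard : ℝ) / (Fintype.card (G i) : ℝ)| ≤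
          t i * (√(A.ncard : ℝ) / √(Fintype.card (G i) : ℝ))) ∧
      -- along any subsequence `n`, for any choice of sets and of basis elements
      (∀ (n : ℕ → ℕ), StrictMono n →
        ∀ (j : ∀ m, Fin (M (n m))) (k : ∀ m, Fin (Fintype.card (G (n m))))
          (A : ∀ m, Set (G (n m))), (∀ m, f (n m) (j m) = (A m).indicator 1) →
        Tendsto (fun m => t (n m) ^ 2 * (Fintype.card (G (n m)) : ℝ) / ((A m).ncard : ℝ))
          atTop (𝓝 0) →
        (fun m => (quantumMeasure (B (n m) (k m))).real (A m)) ~[atTop]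
          fun m => ((A m).ncard : ℝ) / (Fintype.card (G (n m)) : ℝ)) := by
  choose B hB1 hB2 using fun i =>
    exists_orthonormalBasis_isCayleyEigenfunction (hS i) (ht i) (hM i) (f i)
  have hB3 : ∀ i k j (A : Set (G i)), f i j = A.indicator 1 →
      |(quantumMeasure (B i k)).real A - (A.ncard : ℝ) / (Fintype.card (G i) : ℝ)| ≤
        t i * (√(A.ncard : ℝ) / √(Fintype.card (G i) : ℝ)) := by
    intro i k j A hA
    have h := hB2 i k j
    rwa [hA, integral_indicator_one_quantumMeasure, sum_indicator_one,
      norm_toLp_indicator_one] at h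
  refine ⟨B, hB1, hB2, hB3, fun n _ j k A hA hlim => ?_⟩
  exact isEquivalent_div_of_abs_sub_le (fun m => (ht (n m)).le)
    (fun m => Nat.cast_pos.2 Fintype.card_pos) (fun m => Nat.cast_nonneg _)
    (fun m => hB3 _ _ (j m) _ (hA m)) hlim
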